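/- Let $\Sigma_{n,d}$ be the set of finite sums of squares of polynomials in $\mathbb{R}[x_1,\dots,x_n]$ of degree at most $d$, and let $\mathcal{H}=\{\pm(x_1^2-x_1),\dots,\pm(x_n^2-x_n)\}$ be the Boolean axioms. A polynomial $f\in\mathbb{R}[x_1,\dots,x_n]$ is called a degree $d$ sum of squares modulo the Boolean axioms if $f=s_0+\sum_{g\in\mathcal{H}}t_g\,g$ with $t_g\in\Sigma_{n,d}$ for every $g\in\mathcal{H}$ and $s_0\in\Sigma_{n,2d+2}$. Theorem. There is an absolute constant $C>0$ such that for all integers $n\ge 2$ and all $k\in\{1,\dots,n\}$ there are a univariate polynomial $s\in\mathbb{R}[x]$ and a natural number $d\le C\sqrt{kn}\,\log n$ such that $\deg s\le d$ and 1. $s\left(\sum_{i=1}^n x_i\right)$ is a degree $d$ sum of squares modulo the Boolean axioms; 2. $(x-k+1)(x-k)-s(x)\ge 0$ for all $x\in[0,n]$. -/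

import Mathlib

/-- Sums of squares of real polynomials in `n` variables of total degree at most `d`. -/
def SosPoly (n d : ℕ) : Set (MvPolynomial (Fin n) ℝ) :=
  {f | ∃ (m : ℕ) (q : Fin m → MvPolynomial (Fin n) ℝ),
    (∀ i, (q i).totalDegree ≤ d) ∧ f = ∑ i, q i ^ 2}

/-- The maximal total degree of the members of a finite set of polynomials. -/
def maxDegree {n : ℕ} (G : Finset (MvPolynomial (Fin n) ℝ)) : ℕ :=
  G.sup MvPolynomial.totalDegree

/-- The polynomials with a degree `d` sum-of-squares certificate of nonnegativity over the
set where all `g ∈ G` are nonnegative: those of the form `s₀ + ∑ g ∈ G, t g * g`, with every `t g`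
a sum of squares of polynomials of degree at most `d`, and `s₀` a sum of squares of polynomials of
degree at most `2⌈(2d + deg G)/2⌉` (the ceiling is written with natural-number division). -/
def SosCertificate (n d : ℕ) (G : Finset (MvPolynomial (Fin n) ℝ)) :
    Set (MvPolynomial (Fin n) ℝ) :=
  {f | ∃ s₀ ∈ SosPoly n (2 * ((2 * d + maxDegree G + 1) / 2)),
    ∃ t : MvPolynomial (Fin n) ℝ → MvPolynomial (Fin n) ℝ,
      (∀ g ∈ G, t g ∈ SosPoly n d) ∧ f = s₀ + ∑ g ∈ G, t g * g}

open Classical in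
/-- The Boolean axioms `±(xᵢ² - xᵢ)`, `i = 1, …, n`. -/
noncomputable def booleanAxioms (n : ℕ) : Finset (MvPolynomial (Fin n) ℝ) :=
  Finset.univ.image (fun i : Fin n => (MvPolynomial.X i ^ 2 - MvPolynomial.X i :
      MvPolynomial (Fin n) ℝ)) ∪
    Finset.univ.image (fun i : Fin n => (-(MvPolynomial.X i ^ 2 - MvPolynomial.X i) :
      MvPolynomial (Fin n) ℝ))

/-- `f` is a degree `d` sum of squares modulo the Boolean axioms. -/
def IsSosModBoolean {n : ℕ} (d : ℕ) (f : MvPolynomial (Fin n) ℝ) : Prop :=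
  f ∈ SosCertificate n d (booleanAxioms n)

/-! Put s(x) = (x-k+1)(x-k)F(x). The quadratic is negative exactly on (k-1, k), so the inequality
s(x) ≤ (x-k+1)(x-k) on [0, n] follows once F ≥ 1 on [k-1, k] and |F| ≤ 1 on the rest of [0, n]. For
the sum-of-squares condition, F is built so that s is a positive multiple of x(x-1)⋯(x-k) ·
(x+1)⋯(x+k+1) · H(x)². At a Boolean point the first product counts (k+1)-subsets of the support, up
to the factor (k+1)!, hence agrees with a sum of squares of monomials (`sum_prod_sq_boolean`); each
factor of the second agrees with ∑ xᵢ² + j. Agreement on the cube is enough by the combinatorial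
Nullstellensatz (`isSosModBoolean_of_eval_eq`).

With t = x-k+1, F is a product of `peak k t`, an even power of `bump R t` with R = 640k, and an even
power of a polynomial w(x). Each factor is at least 1 on [k-1, k].

The factor `peak` carries the forced simple roots -1, …, -2k in t. These are balanced by double
roots of half the density to the right, so that the size is governed by Euler's product for the
sine; the result is |peak| ≤ exp(12t(t-1)/k) off (0, 1) (`abs_peak_le`). The cubic `bump` is at most
exp(-t(t-1)/(8R²)) for -R ≤ t ≤ 2R off (0, 1), so O(k) copies cancel this growth exactly. Beyond 2R
both factors grow only like a power O(k) of t/R, up to a factor 2^O(k), and w, which decays there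
and stays bounded by 1 elsewhere, absorbs this when raised to a power O(k). Such a w of degree
O(√(n/k)) comes from a Chebyshev polynomial of the second kind (`exists_decaying_polynomial`). The
total degree is O(√(kn)), so the logarithm in the theorem is slack.

For `peak` and w, the bounds near [k-1, k] rest on one principle: a log-concave function with equal
values at two points is at least that value between them and at most that value outside. -/

/-! ### Sums of squares and the Boolean cube -/

theorem SosPoly.of_fintype {n d : ℕ} {ι : Type*} [Fintype ι] (q : ι → MvPolynomial (Fin n) ℝ)
    (hq : ∀ i, (q i).totalDegree ≤ d) : ∑ i, q i ^ 2 ∈ SosPoly n d := by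
  refine ⟨Fintype.card ι, fun i => q ((Fintype.equivFin ι).symm i), fun i => hq _, ?_⟩
  exact (Equiv.sum_comp (Fintype.equivFin ι).symm (fun i => q i ^ 2)).symm

theorem SosPoly.sum_sq {n d : ℕ} {ι : Type*} (s : Finset ι) (q : ι → MvPolynomial (Fin n) ℝ)
    (hq : ∀ i ∈ s, (q i).totalDegree ≤ d) : ∑ i ∈ s, q i ^ 2 ∈ SosPoly n d := by
  rw [← Finset.sum_coe_sort]
  exact SosPoly.of_fintype (fun i : s => q i) fun i => hq _ i.2

theorem SosPoly.sq {n d : ℕ} {q : MvPolynomial (Fin n) ℝ} (hq : q.totalDegree ≤ d) :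
    q ^ 2 ∈ SosPoly n d :=
  ⟨1, fun _ => q, fun _ => hq, by simp⟩

theorem SosPoly.mono {n a b : ℕ} (hab : a ≤ b) {f : MvPolynomial (Fin n) ℝ}
    (hf : f ∈ SosPoly n a) : f ∈ SosPoly n b := by
  obtain ⟨m, q, hq, rfl⟩ := hf
  exact ⟨m, q, fun i => (hq i).trans hab, rfl⟩

theorem SosPoly.add {n d : ℕ} {f g : MvPolynomial (Fin n) ℝ} (hf : f ∈ SosPoly n d)
    (hg : g ∈ SosPoly n d) : f + g ∈ SosPoly n d := by
  obtain ⟨m, q, hq, rfl⟩ := hf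
  obtain ⟨l, p, hp, rfl⟩ := hg
  have := SosPoly.of_fintype (Sum.elim q p) (d := d) (by rintro (i | i) <;> simp [hq, hp])
  simpa using this

theorem SosPoly.mul {n a b : ℕ} {f g : MvPolynomial (Fin n) ℝ} (hf : f ∈ SosPoly n a)
    (hg : g ∈ SosPoly n b) : f * g ∈ SosPoly n (a + b) := by
  obtain ⟨m, q, hq, rfl⟩ := hf
  obtain ⟨l, p, hp, rfl⟩ := hg
  have := SosPoly.of_fintype (fun x : Fin m × Fin l => q x.1 * p x.2) (d := a + b)
    (fun x => (MvPolynomial.totalDegree_mul _ _).trans (add_le_add (hq _) (hp _)))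
  simpa [Fintype.sum_prod_type, Finset.sum_mul_sum, mul_pow] using this

theorem SosPoly.prod {n : ℕ} {ι : Type*} (s : Finset ι) (f : ι → MvPolynomial (Fin n) ℝ)
    (d : ι → ℕ) (hf : ∀ i ∈ s, f i ∈ SosPoly n (d i)) :
    ∏ i ∈ s, f i ∈ SosPoly n (∑ i ∈ s, d i) := by
  classical
  induction s using Finset.induction_on with
  | empty => exact ⟨1, fun _ => 1, by simp, by simp⟩
  | insert i s hi ih =>
    rw [Finset.prod_insert hi, Finset.sum_insert hi]
    exact SosPoly.mul (hf i (by simp)) (ih fun j hj => hf j (by simp [hj]))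

theorem SosPoly.C {n d : ℕ} {c : ℝ} (hc : 0 ≤ c) : MvPolynomial.C c ∈ SosPoly n d := by
  have := SosPoly.sq (n := n) (d := d) (q := MvPolynomial.C (Real.sqrt c)) (by simp)
  rwa [← map_pow, Real.sq_sqrt hc] at this

open MvPolynomial in
theorem SosPoly.totalDegree_le {n d : ℕ} {f : MvPolynomial (Fin n) ℝ} (hf : f ∈ SosPoly n d) :
    f.totalDegree ≤ 2 * d := by
  obtain ⟨m, q, hq, rfl⟩ := hf
  refine totalDegree_finsetSum_le fun i _ => (totalDegree_pow _ _).trans ?_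
  exact Nat.mul_le_mul_left _ (hq i)

open MvPolynomial in
/-- A polynomial agreeing on the Boolean cube with a sum of squares is a sum of squares modulo
the Boolean axioms. -/
theorem isSosModBoolean_of_eval_eq {n d : ℕ} {f g : MvPolynomial (Fin n) ℝ}
    (hf : f.totalDegree ≤ d) (hg : g ∈ SosPoly n (d / 2))
    (h : ∀ x : Fin n → ℝ, (∀ i, x i = 0 ∨ x i = 1) → eval x f = eval x g) :
    IsSosModBoolean d f := by
  classical
  -- `f - g` vanishes on the grid {0, 1}ⁿ, so it is a combination of the Xᵢ² - Xᵢ without degree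
  -- increase.
  obtain ⟨l, hl, hfl⟩ := combinatorial_nullstellensatz_exists_linearCombination
    (fun _ : Fin n => ({0, 1} : Finset ℝ)) (fun _ => by simp) (f - g) (by
      intro x hx
      rw [map_sub, h x (fun i => by simpa using hx i), sub_self])
  set B : Fin n → MvPolynomial (Fin n) ℝ := fun i => X i ^ 2 - X i with hB
  have hprod : ∀ i : Fin n, ∏ r ∈ ({0, 1} : Finset ℝ), (X i - C r) = B i := by
    intro i
    rw [Finset.prod_pair (by norm_num)]
    simp only [hB, map_zero, map_one]
    ring
  have hfg : (f - g).totalDegree ≤ d := by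
    refine (totalDegree_sub _ _).trans (max_le hf ((SosPoly.totalDegree_le hg).trans ?_))
    omega
  have hB0 : ∀ i, B i ≠ 0 := by
    intro i h0
    have := congrArg (eval fun _ => (2 : ℝ)) h0
    norm_num [hB] at this
  have hld : ∀ i, (l i).totalDegree ≤ d := by
    intro i
    by_cases h0 : l i = 0
    · simp [h0]
    · have := hl i
      rw [hprod, totalDegree_mul_of_isDomain (hB0 i) h0] at this
      omega
  have hfeq : f = g + ∑ i, l i * B i := by
    rw [← sub_eq_iff_eq_add', hfl, Finsupp.linearCombination_apply, Finsupp.sum_fintype _ _ (by simp)]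
    simp [hprod]
  have hmul : ∀ (c : ℝ) (i : Fin n), (C (1 / 2) * (l i + C c)).totalDegree ≤ d := by
    intro c i
    refine (totalDegree_mul _ _).trans ?_
    rw [totalDegree_C, zero_add]
    exact (totalDegree_add _ _).trans (max_le (hld i) (by simp))
  -- l = ((l+1)/2)² - ((l-1)/2)²: the first square multiplies the axiom `B i`, the second multiplies
  -- `-B i`.
  set p : Fin n → MvPolynomial (Fin n) ℝ := fun i => (C (1 / 2) * (l i + C 1)) ^ 2 with hp
  set m : Fin n → MvPolynomial (Fin n) ℝ := fun i => (C (1 / 2) * (l i + C (-1))) ^ 2 with hm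
  -- Multipliers are attached to polynomials, not to indices, so contributions are collected over
  -- the fibres of i ↦ ±Bᵢ.
  refine ⟨g, SosPoly.mono (by omega) hg, fun b => ∑ i with B i = b, p i + ∑ i with -B i = b, m i, ?_, ?_⟩
  · intro b _
    exact SosPoly.add (SosPoly.sum_sq _ _ fun i _ => hmul 1 i) (SosPoly.sum_sq _ _ fun i _ => hmul (-1) i)
  · have hpm : ∀ i, l i = p i - m i := by
      intro i
      have h4 : (C (1 / 2) : MvPolynomial (Fin n) ℝ) ^ 2 * 4 = 1 := by
        rw [← map_pow, show (4 : MvPolynomial (Fin n) ℝ) = C 4 from (map_ofNat C 4).symm, ← map_mul]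
        norm_num
      simp only [hp, hm, map_neg, map_one]
      linear_combination (-(l i)) * h4
    have key : ∀ (b q : Fin n → MvPolynomial (Fin n) ℝ), (∀ i, b i ∈ booleanAxioms n) →
        ∑ c ∈ booleanAxioms n, (∑ i with b i = c, q i) * c = ∑ i, q i * b i := by
      intro b q hb
      rw [← Finset.sum_fiberwise_of_maps_to (fun i _ => hb i)]
      refine Finset.sum_congr rfl fun c _ => ?_
      rw [Finset.sum_mul]
      exact Finset.sum_congr rfl fun i hi => by rw [(Finset.mem_filter.1 hi).2]
    rw [hfeq]
    congr 1
    simp only [add_mul, Finset.sum_add_distrib]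
    rw [key B p (fun i => by simp [booleanAxioms, hB]), key (fun i => -B i) m
      (fun i => by simp [booleanAxioms, hB]), ← Finset.sum_add_distrib]
    exact Finset.sum_congr rfl fun i _ => by rw [hpm i]; ring

open MvPolynomial in
theorem totalDegree_aeval_le {n : ℕ} (p : MvPolynomial (Fin n) ℝ) (hp : p.totalDegree ≤ 1)
    (q : Polynomial ℝ) : (Polynomial.aeval p q).totalDegree ≤ q.natDegree := by
  rw [Polynomial.aeval_eq_sum_range]
  refine totalDegree_finsetSum_le fun i hi => (totalDegree_smul_le _ _).trans
    ((totalDegree_pow _ _).trans ?_)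
  have : i ≤ q.natDegree := by simpa [Nat.lt_succ_iff] using hi
  nlinarith

open MvPolynomial in
theorem totalDegree_sum_X_le (n : ℕ) :
    (∑ i : Fin n, X i : MvPolynomial (Fin n) ℝ).totalDegree ≤ 1 :=
  totalDegree_finsetSum_le fun i _ => (totalDegree_X i).le

open MvPolynomial in
theorem eval_aeval_sum_X {n : ℕ} (x : Fin n → ℝ) (q : Polynomial ℝ) :
    eval x (Polynomial.aeval (∑ i : Fin n, X i) q) = q.eval (∑ i, x i) := by
  rw [← coe_aeval_eq_eval, RingHom.coe_coe, ← Polynomial.aeval_algHom_apply]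
  simp

open MvPolynomial in
-- With A the support of x, the sum counts the m-subsets of A, and m! times this count is the
-- descending factorial of |A|.
theorem sum_prod_sq_boolean {n : ℕ} (m : ℕ) (x : Fin n → ℝ) (hx : ∀ i, x i = 0 ∨ x i = 1) :
    (m.factorial : ℝ) * ∑ S ∈ Finset.powersetCard m (Finset.univ : Finset (Fin n)),
      (∏ i ∈ S, x i) ^ 2 = ∏ j ∈ Finset.range m, (∑ i, x i - j) := by
  classical
  set A : Finset (Fin n) := Finset.univ.filter fun i => x i = 1 with hA
  have hsum : ∑ i, x i = (A.card : ℝ) := by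
    rw [hA, Finset.card_filter, Nat.cast_sum]
    refine Finset.sum_congr rfl fun i _ => ?_
    rcases hx i with h | h <;> simp [h]
  have hterm : ∀ S ∈ Finset.powersetCard m (Finset.univ : Finset (Fin n)),
      (∏ i ∈ S, x i) ^ 2 = if S ⊆ A then 1 else 0 := by
    intro S _
    split_ifs with hS
    · rw [Finset.prod_eq_one fun i hi => (Finset.mem_filter.1 (hS hi)).2, one_pow]
    · obtain ⟨i, hi, hiA⟩ := Finset.not_subset.1 hS
      have h0 : x i = 0 := (hx i).resolve_right fun h1 => hiA (by simp [hA, h1])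
      rw [Finset.prod_eq_zero hi h0]
      norm_num
  have hfil : (Finset.powersetCard m (Finset.univ : Finset (Fin n))).filter (· ⊆ A) =
      Finset.powersetCard m A := by
    ext S
    simp only [Finset.mem_filter, Finset.mem_powersetCard, Finset.subset_univ, true_and]
    exact and_comm
  rw [Finset.sum_congr rfl hterm, ← Finset.sum_filter, hfil, Finset.sum_const,
    Finset.card_powersetCard, nsmul_eq_mul, mul_one, hsum, ← Nat.cast_mul,
    ← Nat.descFactorial_eq_factorial_mul_choose, Nat.descFactorial_eq_prod_range]
  by_cases hm : m ≤ A.card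
  · rw [Nat.cast_prod]
    refine Finset.prod_congr rfl fun j hj => ?_
    rw [Nat.cast_sub ((Finset.mem_range.1 hj).le.trans hm)]
  -- Casting does not commute with truncated subtraction here, but both products contain the zero
  -- factor j = |A|.
  · push Not at hm
    rw [Finset.prod_eq_zero (Finset.mem_range.2 hm) (by simp),
      Finset.prod_eq_zero (Finset.mem_range.2 hm) (by simp), Nat.cast_zero]

open MvPolynomial in
/-- Univariate polynomials of a special shape, with roots `0, …, m - 1` and `-1, …, -l` besides
double roots, give sums of squares modulo the Boolean axioms. -/
theorem isSosModBoolean_aeval {n m l d : ℕ} {c : ℝ} (hc : 0 ≤ c) (H s : Polynomial ℝ)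
    (hd : 2 * (m + l + H.natDegree) ≤ d) (hs : s.natDegree ≤ d)
    (heval : ∀ x : ℝ, s.eval x = c * ((∏ j ∈ Finset.range m, (x - j)) *
      ∏ j ∈ Finset.range l, (x + (j + 1))) * H.eval x ^ 2) :
    IsSosModBoolean d (Polynomial.aeval (∑ i : Fin n, X i) s : MvPolynomial (Fin n) ℝ) := by
  -- Since xᵢ = xᵢ² on the cube, the factor ∑ xᵢ + (j+1) is replaced by ∑ xᵢ² + (j+1), which is
  -- itself a sum of squares.
  set g : MvPolynomial (Fin n) ℝ := C c * ((C (m.factorial : ℝ) *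
    ∑ S ∈ Finset.powersetCard m (Finset.univ : Finset (Fin n)), (∏ i ∈ S, X i) ^ 2) *
    ∏ j ∈ Finset.range l, (∑ i : Fin n, X i ^ 2 + C ((j : ℝ) + 1))) *
    (Polynomial.aeval (∑ i : Fin n, X i) H) ^ 2 with hgdef
  have hg : g ∈ SosPoly n (0 + (0 + m + ∑ _j ∈ Finset.range l, 1) + H.natDegree) := by
    refine SosPoly.mul (SosPoly.mul (SosPoly.C hc) (SosPoly.mul
      (SosPoly.mul (SosPoly.C (by positivity)) (SosPoly.sum_sq _ _ ?_))
      (SosPoly.prod _ _ _ ?_))) (SosPoly.sq (totalDegree_aeval_le _ (totalDegree_sum_X_le n) H))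
    · intro S hS
      refine (totalDegree_finsetProd _ _).trans ?_
      simp [(Finset.mem_powersetCard.1 hS).2]
    · intro j _
      exact SosPoly.add (SosPoly.sum_sq _ _ fun i _ => (totalDegree_X i).le) (SosPoly.C (by positivity))
  refine isSosModBoolean_of_eval_eq (g := g)
    ((totalDegree_aeval_le _ (totalDegree_sum_X_le n) s).trans hs) (SosPoly.mono ?_ hg) ?_
  · simp only [Finset.sum_const, Finset.card_range, smul_eq_mul, mul_one]
    omega
  · intro x hx
    have hx2 : ∀ i, x i ^ 2 = x i := fun i => by rcases hx i with h | h <;> simp [h]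
    rw [eval_aeval_sum_X, heval]
    simp only [hgdef, map_mul, map_pow, eval_C, eval_aeval_sum_X, map_prod, map_add, map_sum,
      eval_X, hx2]
    rw [sum_prod_sq_boolean m x hx]

/-! ### Log-concave functions -/

/-- A function is log-concave on a set if it is positive there and its logarithm is concave. -/
def LogConcaveOn (I : Set ℝ) (f : ℝ → ℝ) : Prop :=
  (∀ x ∈ I, 0 < f x) ∧ ConcaveOn ℝ I fun x => Real.log (f x)

theorem LogConcaveOn.mul {I : Set ℝ} {f g : ℝ → ℝ} (hf : LogConcaveOn I f)
    (hg : LogConcaveOn I g) : LogConcaveOn I fun x => f x * g x := by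
  refine ⟨fun x hx => mul_pos (hf.1 x hx) (hg.1 x hx), (hf.2.add hg.2).congr fun x hx => ?_⟩
  exact (Real.log_mul (hf.1 x hx).ne' (hg.1 x hx).ne').symm

theorem LogConcaveOn.const {I : Set ℝ} (hI : Convex ℝ I) {c : ℝ} (hc : 0 < c) :
    LogConcaveOn I fun _ => c :=
  ⟨fun _ _ => hc, concaveOn_const _ hI⟩

theorem LogConcaveOn.prod {I : Set ℝ} (hI : Convex ℝ I) {ι : Type*} (s : Finset ι)
    (f : ι → ℝ → ℝ) (hf : ∀ i ∈ s, LogConcaveOn I (f i)) :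
    LogConcaveOn I fun x => ∏ i ∈ s, f i x := by
  classical
  induction s using Finset.induction_on with
  | empty => simpa using LogConcaveOn.const hI one_pos
  | insert i s hi ih =>
    simp only [Finset.prod_insert hi]
    exact (hf i (by simp)).mul (ih fun j hj => hf j (by simp [hj]))

theorem LogConcaveOn.pow {I : Set ℝ} (hI : Convex ℝ I) {f : ℝ → ℝ} (hf : LogConcaveOn I f)
    (m : ℕ) : LogConcaveOn I fun x => f x ^ m := by
  simpa using LogConcaveOn.prod hI (Finset.range m) (fun _ => f) fun _ _ => hf

theorem LogConcaveOn.affine {I : Set ℝ} (hI : Convex ℝ I) {a b : ℝ} (h : ∀ x ∈ I, 0 < a + b * x) :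
    LogConcaveOn I fun x => a + b * x := by
  refine ⟨h, hI, fun x hx y hy s t hs ht hst => ?_⟩
  have := strictConcaveOn_log_Ioi.concaveOn.2 (h x hx) (h y hy) hs ht hst
  simp only [smul_eq_mul] at this ⊢
  refine this.trans (le_of_eq ?_)
  congr 1
  linear_combination a * hst

theorem LogConcaveOn.le_of_mem_Icc {I : Set ℝ} {f : ℝ → ℝ} (hf : LogConcaveOn I f) {u v x : ℝ}
    (hu : u ∈ I) (hv : v ∈ I) (huv : f u = f v) (hux : u ≤ x) (hxv : x ≤ v) : f u ≤ f x := by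
  have hxI : x ∈ I := hf.2.1.ordConnected.out hu hv ⟨hux, hxv⟩
  have := hf.2.ge_on_segment hu hv (z := x) (by rw [segment_eq_Icc (hux.trans hxv)]; exact ⟨hux, hxv⟩)
  simp only [← huv, min_self] at this
  exact (Real.log_le_log_iff (hf.1 u hu) (hf.1 x hxI)).1 this

/-- The chord of log f over [u, v] is horizontal, so by concavity chords to its left have
nonnegative slope. -/
theorem LogConcaveOn.le_of_le_left {I : Set ℝ} {f : ℝ → ℝ} (hf : LogConcaveOn I f) {u v x : ℝ}
    (hx : x ∈ I) (hv : v ∈ I) (huv : f u = f v) (hxu : x ≤ u) (hlt : u < v) : f x ≤ f u := by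
  rcases hxu.eq_or_lt with rfl | hxu
  · exact le_rfl
  have hu : u ∈ I := hf.2.1.ordConnected.out hx hv ⟨hxu.le, hlt.le⟩
  have := hf.2.slope_anti_adjacent hx hv hxu hlt
  simp only [← huv, sub_self, zero_div] at this
  have h2 : 0 ≤ Real.log (f u) - Real.log (f x) := by
    by_contra hneg
    push Not at hneg
    exact absurd this (not_le.2 (div_neg_of_neg_of_pos hneg (sub_pos.2 hxu)))
  exact (Real.log_le_log_iff (hf.1 x hx) (hf.1 u hu)).1 (by linarith)

theorem LogConcaveOn.le_of_le_right {I : Set ℝ} {f : ℝ → ℝ} (hf : LogConcaveOn I f) {u v x : ℝ}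
    (hu : u ∈ I) (hx : x ∈ I) (huv : f u = f v) (hvx : v ≤ x) (hlt : u < v) : f x ≤ f u := by
  rcases hvx.eq_or_lt with rfl | hvx
  · exact huv.ge
  have hv : v ∈ I := hf.2.1.ordConnected.out hu hx ⟨hlt.le, hvx.le⟩
  have := hf.2.slope_anti_adjacent hu hx hlt hvx
  simp only [← huv, sub_self, zero_div] at this
  have h2 : Real.log (f x) - Real.log (f u) ≤ 0 := by
    by_contra hneg
    push Not at hneg
    exact absurd this (not_le.2 (div_pos hneg (sub_pos.2 hvx)))
  exact (Real.log_le_log_iff (hf.1 x hx) (hf.1 u hu)).1 (by linarith)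

/-! ### Chebyshev kernels and the decaying polynomial -/

open Polynomial in
/-- The Chebyshev polynomial of the second kind, transported to `[0, N]` and with value `1`
at `0`. -/
noncomputable def chebyshevKernel (N : ℝ) (j : ℕ) : ℝ[X] :=
  C (1 / ((j : ℝ) + 1)) * (Chebyshev.U ℝ j).comp (C 1 - C (1 / N) * X)

theorem chebyshevKernel_eval (N : ℝ) (j : ℕ) (x : ℝ) : (chebyshevKernel N j).eval x =
    1 / ((j : ℝ) + 1) * (Polynomial.Chebyshev.U ℝ j).eval (1 - x / N) := by
  simp [chebyshevKernel, div_eq_inv_mul]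

theorem chebyshevKernel_zero (N : ℝ) (j : ℕ) : (chebyshevKernel N j).eval 0 = 1 := by
  rw [chebyshevKernel_eval, zero_div, sub_zero, Polynomial.Chebyshev.U_eval_one]
  push_cast
  field_simp

theorem natDegree_chebyshevKernel_le (N : ℝ) (j : ℕ) : (chebyshevKernel N j).natDegree ≤ j := by
  refine (Polynomial.natDegree_C_mul_le _ _).trans ?_
  rw [Polynomial.natDegree_comp, Polynomial.Chebyshev.natDegree_U_natCast]
  calc j * _ ≤ j * 1 := Nat.mul_le_mul_left _ (by compute_degree)
    _ = j := mul_one j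

/-- This is |U_j(cos θ) sin θ| ≤ 1. The substitution y = 1 - x/N maps [0, N] onto [0, 1] only, away
from the other endpoint -1, so 1 - y² ≥ x/N throughout. -/
theorem chebyshevKernel_sq_le {N : ℝ} (j : ℕ) {x : ℝ} (hx : 0 < x) (hxN : x ≤ N) :
    (chebyshevKernel N j).eval x ^ 2 ≤ N / ((j : ℝ) + 1) ^ 2 / x := by
  have hN : 0 < N := hx.trans_le hxN
  have hj : (0 : ℝ) < (j : ℝ) + 1 := by positivity
  have h1 : x / N ≤ 1 := (div_le_one hN).2 hxN
  have h0 : 0 < x / N := by positivity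
  set y := 1 - x / N with hy
  have hcos : Real.cos (Real.arccos y) = y := Real.cos_arccos (by linarith) (by linarith)
  have hU := Polynomial.Chebyshev.U_real_cos (Real.arccos y) j
  rw [hcos] at hU
  have hs : Real.sin (Real.arccos y) ^ 2 = 1 - y ^ 2 := by
    rw [Real.sin_sq, hcos]
  have hU2 : (Polynomial.Chebyshev.U ℝ j).eval y ^ 2 * (1 - y ^ 2) ≤ 1 := by
    rw [← hs, ← mul_pow, hU]
    exact Real.sin_sq_le_one _
  have hy2 : x / N ≤ 1 - y ^ 2 := by rw [hy]; nlinarith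
  rw [chebyshevKernel_eval, ← hy, mul_pow, div_pow, one_pow, div_div, le_div_iff₀ (by positivity)]
  have : (Polynomial.Chebyshev.U ℝ j).eval y ^ 2 * (x / N) ≤ 1 :=
    (mul_le_mul_of_nonneg_left hy2 (sq_nonneg _)).trans hU2
  rw [mul_div_assoc', div_le_one hN] at this
  field_simp
  linarith

theorem chebyshevKernel_eq_prod (N : ℝ) (j : ℕ) (x : ℝ) : (chebyshevKernel N j).eval x =
    2 ^ j / ((j : ℝ) + 1) *
      ∏ k ∈ Finset.range j, (1 - Real.cos ((k + 1) * Real.pi / (j + 1)) + (-(1 / N)) * x) := by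
  have hinj : Set.InjOn (fun k : ℕ => Real.cos ((k + 1) * Real.pi / (j + 1))) (Finset.range j) :=
    (Finset.range j).nodup_map_iff_injOn.mp (Polynomial.Chebyshev.roots_U_real_nodup j)
  have hroots := Polynomial.Chebyshev.roots_U_real j
  have hcard : (Polynomial.Chebyshev.U ℝ j).roots.card = (Polynomial.Chebyshev.U ℝ j).natDegree := by
    rw [hroots, Polynomial.Chebyshev.natDegree_U_natCast, Finset.card_val,
      Finset.card_image_of_injOn hinj, Finset.card_range]
  have hU := Polynomial.C_leadingCoeff_mul_prod_multiset_X_sub_C hcard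
  rw [chebyshevKernel_eval, ← hU, Polynomial.Chebyshev.leadingCoeff_U_natCast, hroots]
  change 1 / ((j : ℝ) + 1) * Polynomial.eval (1 - x / N) (Polynomial.C (2 ^ j) * ∏ a ∈ (Finset.range j).image
      (fun k : ℕ => Real.cos ((k + 1) * Real.pi / (j + 1))), (Polynomial.X - Polynomial.C a)) = _
  rw [Finset.prod_image hinj, Polynomial.eval_mul, Polynomial.eval_C, Polynomial.eval_prod,
    ← mul_assoc, one_div_mul_eq_div]
  congr 1
  refine Finset.prod_congr rfl fun k _ => ?_
  simp only [Polynomial.eval_sub, Polynomial.eval_X, Polynomial.eval_C]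
  ring

theorem chebyshevKernel_factor_pos {N : ℝ} (hN : 0 < N) {j k : ℕ} (hk : k < j) {x : ℝ}
    (hx : x < N * (1 - Real.cos (Real.pi / (j + 1)))) :
    0 < 1 - Real.cos ((k + 1) * Real.pi / (j + 1)) + (-(1 / N)) * x := by
  have hj : (0 : ℝ) < (j : ℝ) + 1 := by positivity
  have h1 : Real.cos ((k + 1) * Real.pi / (j + 1)) ≤ Real.cos (Real.pi / (j + 1)) := by
    refine Real.cos_le_cos_of_nonneg_of_le_pi (by positivity) ?_ ?_
    · rw [div_le_iff₀ hj]
      have : (k : ℝ) + 1 ≤ j + 1 := by exact_mod_cast (by omega : k + 1 ≤ j + 1)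
      nlinarith [Real.pi_pos]
    · gcongr
      nlinarith [Real.pi_pos, (Nat.cast_nonneg k : (0 : ℝ) ≤ k)]
  have h2 : x / N < 1 - Real.cos (Real.pi / (j + 1)) := by
    rw [div_lt_iff₀ hN]; linarith
  have h3 : -(1 / N) * x = -(x / N) := by ring
  rw [h3]; linarith

/-- Left of the smallest root every linear factor is positive. -/
theorem logConcaveOn_chebyshevKernel {N : ℝ} (hN : 0 < N) (j : ℕ) :
    LogConcaveOn (Set.Iio (N * (1 - Real.cos (Real.pi / (j + 1)))))
      fun x => (chebyshevKernel N j).eval x := by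
  simp only [chebyshevKernel_eq_prod]
  refine (LogConcaveOn.const (convex_Iio _) (by positivity)).mul
    (LogConcaveOn.prod (convex_Iio _) _ _ fun k hk => LogConcaveOn.affine (convex_Iio _) fun x hx => ?_)
  exact chebyshevKernel_factor_pos hN (Finset.mem_range.1 hk) hx

theorem chebyshevKernel_strictAntiOn {N : ℝ} (hN : 0 < N) {j : ℕ} (hj : 1 ≤ j) {x y : ℝ}
    (hxy : x < y) (hy : y < N * (1 - Real.cos (Real.pi / (j + 1)))) :
    (chebyshevKernel N j).eval y < (chebyshevKernel N j).eval x := by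
  simp only [chebyshevKernel_eq_prod]
  refine mul_lt_mul_of_pos_left ?_ (by positivity)
  have : -(1 / N) * y < -(1 / N) * x := by
    have : 0 < 1 / N := by positivity
    nlinarith
  refine Finset.prod_lt_prod (fun k hk => chebyshevKernel_factor_pos hN (Finset.mem_range.1 hk) hy)
    (fun k _ => by linarith) ⟨0, Finset.mem_range.2 (by omega), by linarith⟩

/-- Lower bound for the kernel far away from its first root. -/
theorem exists_chebyshevKernel_ge {N : ℝ} (hN : 0 < N) {j : ℕ} :
    ∃ v, N / ((j : ℝ) + 1) ^ 2 / 2 ≤ v ∧ v < N * (1 - Real.cos (Real.pi / (j + 1))) ∧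
      2 / Real.pi ≤ (chebyshevKernel N j).eval v := by
  have hj : (0 : ℝ) < (j : ℝ) + 1 := by positivity
  have hj1 : (1 : ℝ) ≤ (j : ℝ) + 1 := by linarith [(Nat.cast_nonneg j : (0 : ℝ) ≤ j)]
  -- Half the angle of the first root: there sin((j+1)θ) = 1, so U_j(cos θ) = 1/sin θ ≥ 1/θ.
  set θ := Real.pi / (2 * ((j : ℝ) + 1)) with hθ
  have hpi := Real.pi_pos
  have hθ0 : 0 < θ := by positivity
  have hθ1 : θ ≤ Real.pi / 2 := by
    rw [hθ]; gcongr; linarith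
  have h2θ : Real.pi / (j + 1) = 2 * θ := by rw [hθ]; field_simp
  refine ⟨N * (1 - Real.cos θ), ?_, ?_, ?_⟩
  · have := Real.cos_le_one_sub_mul_cos_sq (x := θ) (by rw [abs_of_pos hθ0]; linarith)
    have h3 : 2 / Real.pi ^ 2 * θ ^ 2 = 1 / ((j : ℝ) + 1) ^ 2 / 2 := by
      rw [hθ]; field_simp
    rw [h3] at this
    calc _ = N * (1 / ((j : ℝ) + 1) ^ 2 / 2) := by ring
      _ ≤ _ := mul_le_mul_of_nonneg_left (by linarith) hN.le
  · rw [h2θ]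
    have : Real.cos (2 * θ) < Real.cos θ :=
      Real.cos_lt_cos_of_nonneg_of_le_pi hθ0.le (by linarith) (by linarith)
    exact mul_lt_mul_of_pos_left (by linarith) hN
  · rw [chebyshevKernel_eval, mul_div_cancel_left₀ _ hN.ne', sub_sub_cancel]
    have hU := Polynomial.Chebyshev.U_real_cos θ j
    have h1 : (((j : ℤ) : ℝ) + 1) * θ = Real.pi / 2 := by rw [hθ]; push_cast; field_simp
    rw [h1, Real.sin_pi_div_two] at hU
    have hs : 0 < Real.sin θ := Real.sin_pos_of_pos_of_lt_pi hθ0 (by linarith)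
    have hs2 := Real.sin_le hθ0.le
    rw [eq_div_of_mul_eq hs.ne' hU, one_div_mul_one_div, div_le_div_iff₀ hpi (by positivity), hθ] at *
    have : ((j : ℝ) + 1) * Real.sin (Real.pi / (2 * ((j : ℝ) + 1))) ≤ Real.pi / 2 := by
      calc _ ≤ ((j : ℝ) + 1) * (Real.pi / (2 * ((j : ℝ) + 1))) := by gcongr
        _ = _ := by field_simp
    linarith

theorem chebyshevKernel_root_ge {N : ℝ} (hN : 0 < N) (j : ℕ) :
    2 * (N / ((j : ℝ) + 1) ^ 2) ≤ N * (1 - Real.cos (Real.pi / (j + 1))) := by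
  have hj1 : (1 : ℝ) ≤ (j : ℝ) + 1 := by linarith [(Nat.cast_nonneg j : (0 : ℝ) ≤ j)]
  have hpi := Real.pi_pos
  have := Real.cos_le_one_sub_mul_cos_sq (x := Real.pi / ((j : ℝ) + 1)) (by
    rw [abs_of_pos (by positivity)]; exact div_le_self hpi.le hj1)
  have h3 : 2 / Real.pi ^ 2 * (Real.pi / ((j : ℝ) + 1)) ^ 2 = 2 * (1 / ((j : ℝ) + 1) ^ 2) := by
    field_simp
  rw [h3] at this
  calc _ = N * (2 * (1 / ((j : ℝ) + 1) ^ 2)) := by ring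
    _ ≤ _ := mul_le_mul_of_nonneg_left (by linarith) hN.le

theorem LogConcaveOn.mono {I J : Set ℝ} {f : ℝ → ℝ} (hf : LogConcaveOn I f) (hJ : J ⊆ I)
    (hJc : Convex ℝ J) : LogConcaveOn J f :=
  ⟨fun x hx => hf.1 x (hJ hx), hf.2.subset hJ hJc⟩

/-- By log-concavity, the drop of log h across [k-1, k] is at most the average rate of drop over [k,
v], where v is the point of `exists_chebyshevKernel_ge`. The total drop there is at most 1/2 and v -
k ≥ X/4, giving a rate of at most 2/X. -/
theorem chebyshevKernel_ratio_le {N : ℝ} (hN : 0 < N) {j : ℕ} {k X : ℝ} (hj : 1 ≤ j)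
    (hX : X = N / ((j : ℝ) + 1) ^ 2) (hk : 1 ≤ k) (hkX : 160 * k ≤ X) :
    ((chebyshevKernel N j).eval (k - 1) / (chebyshevKernel N j).eval k) ^ 20 ≤ 1 + 80 / X := by
  have hroot := chebyshevKernel_root_ge hN j
  have hLC := logConcaveOn_chebyshevKernel hN j
  obtain ⟨v, hv1, hv2, hv3⟩ := exists_chebyshevKernel_ge hN (j := j)
  rw [← hX] at hroot hv1
  set B := N * (1 - Real.cos (Real.pi / (j + 1))) with hB
  set h := fun x => (chebyshevKernel N j).eval x with hh
  have hkB : k < B := by linarith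
  have hX0 : 0 < X := by linarith
  have hb1 : h k ≤ 1 := by
    rw [← chebyshevKernel_zero N j]
    exact (chebyshevKernel_strictAntiOn hN hj (by linarith) hkB).le
  have hb : 0 < h k := hLC.1 k hkB
  have ha : 0 < h (k - 1) := hLC.1 (k - 1) (by simp only [Set.mem_Iio]; linarith)
  have hslope := hLC.2.slope_anti_adjacent (x := k - 1) (y := k) (z := v)
    (by simp only [Set.mem_Iio]; linarith) hv2 (by linarith) (by linarith)
  have hpi := Real.pi_pos
  have hlogv : -(1 / 2) ≤ Real.log (h v) := by
    refine le_trans ?_ (Real.log_le_log (by positivity) hv3)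
    rw [Real.le_log_iff_exp_le (by positivity), Real.exp_neg, inv_le_comm₀ (Real.exp_pos _)
      (by positivity), inv_div]
    have := Real.quadratic_le_exp_of_nonneg (x := 1 / 2) (by norm_num)
    have := Real.pi_lt_d2
    linarith
  have hlogb : Real.log (h k) ≤ 0 := Real.log_nonpos hb.le hb1
  have hdiff : Real.log (h (k - 1)) - Real.log (h k) ≤ 2 / X := by
    have h1 : -(2 / X) ≤ (Real.log (h v) - Real.log (h k)) / (v - k) := by
      rw [le_div_iff₀ (by linarith)]
      have h3 : 2 / X * (X / 4) = 1 / 2 := by field_simp; norm_num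
      have h4 : 2 / X * (X / 4) ≤ 2 / X * (v - k) :=
        mul_le_mul_of_nonneg_left (by linarith) (by positivity)
      linarith
    have h2 := h1.trans hslope
    rw [sub_sub_cancel, div_one] at h2
    linarith
  have heq : (h (k - 1) / h k) ^ 20 = Real.exp (20 * (Real.log (h (k - 1)) - Real.log (h k))) := by
    rw [← Real.log_div ha.ne' hb.ne', mul_comm, Real.exp_mul, Real.exp_log (by positivity)]
    norm_cast
  change (h (k - 1) / h k) ^ 20 ≤ _
  rw [heq]
  have h40 : 40 / X ≤ 1 := by rw [div_le_one hX0]; linarith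
  have h5 := Real.abs_exp_sub_one_le (x := 40 / X) (by rw [abs_of_pos (by positivity)]; exact h40)
  rw [abs_of_pos (show 0 < 40 / X by positivity)] at h5
  have h6 : Real.exp (20 * (Real.log (h (k - 1)) - Real.log (h k))) ≤ Real.exp (40 / X) := by
    apply Real.exp_le_exp.2
    calc _ ≤ 20 * (2 / X) := by linarith
      _ = 40 / X := by ring
  have h7 : 80 / X = 2 * (40 / X) := by ring
  linarith [le_abs_self (Real.exp (40 / X) - 1)]

/-- A polynomial of low degree that peaks on `[k - 1, k]` and decays on a scale proportional
to `X`. -/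
theorem exists_decaying_polynomial {N : ℝ} (hN : 0 < N) {j : ℕ} {k X : ℝ} (hj : 1 ≤ j)
    (hX : X = N / ((j : ℝ) + 1) ^ 2) (hk : 1 ≤ k) (hkX : 160 * k ≤ X) :
    ∃ w : Polynomial ℝ, w.natDegree ≤ 1 + 20 * j ∧ (∀ x, k - 1 ≤ x → x ≤ k → 1 ≤ w.eval x) ∧
      (∀ x, 0 ≤ x → x ≤ N → x ≤ k - 1 ∨ k ≤ x → |w.eval x| ≤ 1) ∧
      ∀ x, X ≤ x → x ≤ N → |w.eval x| ≤ 161 * (X / x) ^ 9 := by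
  have hratio := chebyshevKernel_ratio_le hN hj hX hk hkX
  have hroot := chebyshevKernel_root_ge hN j
  have hLC := logConcaveOn_chebyshevKernel hN j
  rw [← hX] at hroot
  set B := N * (1 - Real.cos (Real.pi / (j + 1))) with hB
  have hkB : k < B := by linarith
  have hX0 : 0 < X := by linarith
  set a := (chebyshevKernel N j).eval (k - 1) with ha_def
  set b := (chebyshevKernel N j).eval k with hb_def
  have hb : 0 < b := hLC.1 k hkB
  have hab : b < a := chebyshevKernel_strictAntiOn hN hj (by linarith) hkB
  have ha : 0 < a := hb.trans hab
  set q := (a / b) ^ 20 with hq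
  have hq1 : 0 < q - 1 := by
    have : 1 < a / b := (one_lt_div hb).2 hab
    have := one_lt_pow₀ this (n := 20) (by norm_num)
    linarith
  have hqb : q * b ^ 20 = a ^ 20 := by rw [hq]; field_simp
  -- Solves (α + k)/(α + k - 1) = q, so that the increasing factor x + α compensates the drop of the
  -- kernel's 20th power between k-1 and k; c below then makes both values equal to 1.
  set α := 1 / (q - 1) - (k - 1) with hα
  have hαX : X / 160 ≤ α := by
    have : X / 80 ≤ 1 / (q - 1) := by
      rw [le_div_iff₀ hq1]
      calc X / 80 * (q - 1) ≤ X / 80 * (80 / X) := by gcongr; linarith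
        _ = 1 := by field_simp
    linarith
  have hα0 : 0 < α := by linarith
  set c := (q - 1) / a ^ 20 with hc
  have hc0 : 0 < c := by positivity
  set w : Polynomial ℝ := Polynomial.C c * (Polynomial.X + Polynomial.C α) *
    chebyshevKernel N j ^ 20 with hw
  have hweval : ∀ x, w.eval x = c * (α + 1 * x) * (chebyshevKernel N j).eval x ^ 20 := by
    intro x
    simp only [hw, Polynomial.eval_mul, Polynomial.eval_C, Polynomial.eval_add, Polynomial.eval_X,
      Polynomial.eval_pow]
    ring
  have hw1 : w.eval (k - 1) = 1 := by
    rw [hweval, ← ha_def, hα, hc]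
    field_simp
    ring
  have hw2 : w.eval k = 1 := by
    rw [hweval, ← hb_def, hα, hc, ← hqb]
    have : q ≠ 0 := by linarith
    field_simp
    ring
  have hwLC : LogConcaveOn (Set.Ico 0 B) fun x => w.eval x := by
    simp only [hweval]
    exact ((LogConcaveOn.const (convex_Ico _ _) hc0).mul (LogConcaveOn.affine (convex_Ico _ _)
      fun x hx => by linarith [hx.1])).mul
      ((hLC.mono (fun x hx => hx.2) (convex_Ico _ _)).pow (convex_Ico _ _) 20)
  have hmem : ∀ x, 0 ≤ x → x < B → x ∈ Set.Ico 0 B := fun x h1 h2 => ⟨h1, h2⟩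
  have hu := hmem (k - 1) (by linarith) (by linarith)
  have hv := hmem k (by linarith) hkB
  have huv : w.eval (k - 1) = w.eval k := hw1.trans hw2.symm
  -- cα is w(0), and 0 lies to the left of the level pair k-1, k.
  have hcα : c * α ≤ 1 := by
    have := hwLC.le_of_le_left (hmem 0 le_rfl (by linarith)) hv huv (by linarith) (by linarith)
    simp only [hweval 0, chebyshevKernel_zero] at this
    rw [hw1] at this
    linarith
  have hdecay : ∀ x, X ≤ x → x ≤ N → |w.eval x| ≤ 161 * (X / x) ^ 9 := by
    intro x hx hxN
    have hx0 : 0 < x := by linarith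
    have hsq := chebyshevKernel_sq_le j hx0 hxN
    rw [← hX] at hsq
    have h20 : (chebyshevKernel N j).eval x ^ 20 ≤ (X / x) ^ 10 := by
      rw [show (20 : ℕ) = 2 * 10 by norm_num, pow_mul]
      exact pow_le_pow_left₀ (sq_nonneg _) hsq 10
    have h20' : 0 ≤ (chebyshevKernel N j).eval x ^ 20 := Even.pow_nonneg (by decide) _
    have hcX : c * (α + 1 * x) ≤ 161 * (x / X) := by
      have h1 : 1 ≤ x / X := (one_le_div hX0).2 hx
      have h2 : c * x ≤ 160 * (x / X) := by
        have h3 : c * (X / 160) ≤ 1 := (mul_le_mul_of_nonneg_left hαX hc0.le).trans hcα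
        calc c * x = (c * (X / 160)) * (160 * (x / X)) := by field_simp
          _ ≤ 1 * (160 * (x / X)) := mul_le_mul_of_nonneg_right h3 (by positivity)
          _ = _ := one_mul _
      linarith
    rw [hweval, abs_of_nonneg (by positivity)]
    calc _ ≤ 161 * (x / X) * (X / x) ^ 10 := mul_le_mul hcX h20 h20' (by positivity)
      _ = 161 * (X / x) ^ 9 := by field_simp
  refine ⟨w, ?_, fun x h1 h2 => ?_, fun x h0 hxN hx => ?_, hdecay⟩
  · refine Polynomial.natDegree_mul_le.trans (add_le_add ?_ ?_)
    · refine (Polynomial.natDegree_C_mul_le _ _).trans ?_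
      rw [Polynomial.natDegree_X_add_C]
    · exact Polynomial.natDegree_pow_le.trans
        (Nat.mul_le_mul_left _ (natDegree_chebyshevKernel_le N j))
  · rw [← hw1]
    exact hwLC.le_of_mem_Icc hu hv huv h1 h2
  · by_cases hxB : x < B
    · have hxI := hmem x h0 hxB
      rw [abs_of_pos (hwLC.1 x hxI), ← hw1]
      rcases hx with hx | hx
      · exact hwLC.le_of_le_left hxI hv huv hx (by linarith)
      · exact hwLC.le_of_le_right hu hxI huv hx (by linarith)
    -- Past the first root log-concavity is lost, but that root is at least 2X, and 161/2⁹ < 1.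
    · push Not at hxB
      have hx2 : 2 * X ≤ x := hroot.trans hxB
      refine (hdecay x (by linarith) hxN).trans ?_
      have : X / x ≤ 1 / 2 := by
        rw [div_le_div_iff₀ (by linarith) (by norm_num)]; linarith
      have := pow_le_pow_left₀ (by positivity) this 9
      norm_num at this ⊢
      linarith

theorem exists_decaying_polynomial_nat {n k : ℕ} (hk : 1 ≤ k) (hkn : k ≤ n) :
    ∃ w : Polynomial ℝ, (k : ℝ) * w.natDegree ≤ 20 * Real.sqrt (k * n) ∧
      (∀ x : ℝ, k - 1 ≤ x → x ≤ k → 1 ≤ w.eval x) ∧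
      (∀ x : ℝ, 0 ≤ x → x ≤ n → x ≤ k - 1 ∨ (k : ℝ) ≤ x → |w.eval x| ≤ 1) ∧
      ∀ x : ℝ, 1280 * k ≤ x → x ≤ n → |w.eval x| ≤ 1280 * k / x / 2 := by
  have hk1 : (1 : ℝ) ≤ k := by exact_mod_cast hk
  have hkn' : (k : ℝ) ≤ n := by exact_mod_cast hkn
  by_cases hn : (n : ℝ) < 1280 * k
  -- The decay range 1280k ≤ x ≤ n is empty, so a constant suffices.
  · refine ⟨1, by rw [Polynomial.natDegree_one, Nat.cast_zero, mul_zero]; positivity, by simp, by simp, fun x h1 h2 => ?_⟩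
    linarith
  push Not at hn
  -- With j + 1 = ⌊σ⌋ ≥ 2 one has ⌊σ⌋ ≤ σ ≤ (3/2)⌊σ⌋, which places X between 160k and 360k.
  set σ := Real.sqrt (n / (160 * k)) with hσ
  have hσ2 : σ ^ 2 = n / (160 * k) := Real.sq_sqrt (by positivity)
  have hσ2' : σ ≥ 2 := by
    refine Real.le_sqrt_of_sq_le ?_
    rw [le_div_iff₀ (by positivity)]; linarith
  set m := ⌊σ⌋₊ with hm
  have hmle : (m : ℝ) ≤ σ := Nat.floor_le (by linarith)
  have hmlt : σ < m + 1 := Nat.lt_floor_add_one σ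
  have hm2 : 2 ≤ m := Nat.le_floor (by exact_mod_cast hσ2')
  have hm2' : (2 : ℝ) ≤ m := by exact_mod_cast hm2
  obtain ⟨j, hj⟩ : ∃ j, m = j + 1 := ⟨m - 1, by omega⟩
  clear_value m
  subst hj
  set X := (n : ℝ) / ((j : ℝ) + 1) ^ 2 with hX
  have hjm : ((j + 1 : ℕ) : ℝ) = (j : ℝ) + 1 := by push_cast; ring
  rw [hjm] at hmle hmlt hm2'
  have hnσ : (n : ℝ) = 160 * k * σ ^ 2 := by rw [hσ2]; field_simp
  have hX1 : 160 * k ≤ X := by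
    rw [hX, le_div_iff₀ (by positivity), hnσ]
    gcongr
  have hX2 : X ≤ 360 * k := by
    rw [hX, div_le_iff₀ (by positivity), hnσ]
    have : σ ^ 2 ≤ (3 / 2 * ((j : ℝ) + 1)) ^ 2 := pow_le_pow_left₀ (by linarith) (by linarith) 2
    have := mul_le_mul_of_nonneg_left this (by positivity : (0 : ℝ) ≤ 160 * k)
    linarith
  obtain ⟨w, h1, h2, h3, h4⟩ := exists_decaying_polynomial (N := n) (by linarith) (j := j) (k := k)
    (by omega) hX hk1 hX1
  refine ⟨w, ?_, h2, h3, fun x hx hxn => ?_⟩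
  · have hdeg : (w.natDegree : ℝ) ≤ 20 * σ := by
      have : (w.natDegree : ℝ) ≤ 1 + 20 * j := by exact_mod_cast h1
      linarith
    have hkσ : k * σ ≤ Real.sqrt (k * n) := by
      refine Real.le_sqrt_of_sq_le ?_
      rw [mul_pow, hσ2]
      have : (k : ℝ) ^ 2 * (n / (160 * k)) = k * n / 160 := by field_simp
      rw [this]
      have : (0 : ℝ) ≤ k * n := by positivity
      linarith
    calc (k : ℝ) * w.natDegree ≤ k * (20 * σ) := by gcongr
      _ = 20 * (k * σ) := by ring
      _ ≤ _ := by gcongr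
  · have hx0 : 0 < x := by linarith
    refine (h4 x (by linarith) hxn).trans ?_
    set y := 1280 * k / x with hy
    have hy0 : 0 < y := by positivity
    have hy1 : y ≤ 1 := (div_le_one hx0).2 hx
    have hXy : X / x ≤ 9 / 32 * y := by
      rw [hy, div_le_iff₀ hx0]
      field_simp
      linarith
    have h5 : (X / x) ^ 9 ≤ (9 / 32 * y) ^ 9 := pow_le_pow_left₀ (by positivity) hXy 9
    have h6 : y ^ 9 ≤ y := by
      simpa using pow_le_pow_of_le_one hy0.le hy1 (show 1 ≤ 9 by norm_num)
    rw [mul_pow] at h5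
    norm_num at h5
    linarith

/-! ### Truncated Euler products of the sine -/

/-- For integral y = m the product is the binomial coefficient (m+J choose J). -/
theorem prod_one_add_div_le_two_pow {y : ℝ} (hy : 0 ≤ y) {m : ℕ} (hym : y ≤ m) (J : ℕ) :
    ∏ i ∈ Finset.range J, (1 + y / (i + 1)) ≤ 2 ^ (m + J) := by
  have hchoose : ∏ i ∈ Finset.range J, (1 + (m : ℝ) / (i + 1)) = ((m + J).choose J : ℝ) := by
    induction J with
    | zero => simp
    | succ J ih =>
      have h := Nat.add_one_mul_choose_eq (m + J) J
      have h' : ((m : ℝ) + J + 1) * ((m + J).choose J : ℝ) =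
          ((m + (J + 1)).choose (J + 1) : ℝ) * (J + 1) := by exact_mod_cast h
      rw [Finset.prod_range_succ, ih]
      field_simp
      linarith
  calc _ ≤ ∏ i ∈ Finset.range J, (1 + (m : ℝ) / (i + 1)) := by
        refine Finset.prod_le_prod (fun i _ => by positivity) fun i _ => ?_
        gcongr
    _ = ((m + J).choose J : ℝ) := hchoose
    _ ≤ 2 ^ (m + J) := by exact_mod_cast Nat.choose_le_two_pow _ _

/-- The absolute value of the truncated Euler product of `sin (π y) / (π y)`. -/
noncomputable def sineProd (J : ℕ) (y : ℝ) : ℝ :=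
  ∏ i ∈ Finset.range J, |1 - y ^ 2 / ((i : ℝ) + 1) ^ 2|

theorem sineProd_nonneg (J : ℕ) (y : ℝ) : 0 ≤ sineProd J y :=
  Finset.prod_nonneg fun _ _ => abs_nonneg _

theorem sineProd_succ (J : ℕ) (y : ℝ) :
    sineProd (J + 1) y = sineProd J y * |1 - y ^ 2 / ((J : ℝ) + 1) ^ 2| :=
  Finset.prod_range_succ _ _

/-- The full product is |sin(πy)|/(πy) ≤ 1/(πy). Each omitted factor 1 - s, s = y²/(i+1)² ≤ 1/2, is
at least exp(-2s), and the sum of the omitted s telescopes to at most y²/J. -/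
theorem sineProd_le_of_small {J : ℕ} (hJ : 1 ≤ J) {y : ℝ} (hy : 0 < y) (hyJ : 2 * y ^ 2 ≤ (J : ℝ) ^ 2) :
    sineProd J y ≤ Real.exp (2 * y ^ 2 / J) / (Real.pi * y) := by
  have hpi := Real.pi_pos
  have hJ0 : (0 : ℝ) < J := by exact_mod_cast hJ
  have hlow : ∀ n, J ≤ n →
      sineProd J y * Real.exp (-(2 * y ^ 2 * (1 / J - 1 / n))) ≤ sineProd n y := by
    intro n hn
    induction n, hn using Nat.le_induction with
    | base => simp
    | succ n hn ih =>
      have hn0 : (0 : ℝ) < n := hJ0.trans_le (by exact_mod_cast hn)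
      have hJn : (J : ℝ) ≤ n := by exact_mod_cast hn
      set s := y ^ 2 / ((n : ℝ) + 1) ^ 2 with hs
      have hs0 : 0 ≤ s := by positivity
      have hs2 : 2 * s ≤ 1 := by
        rw [hs, mul_div_assoc', div_le_one (by positivity)]
        nlinarith
      have hexp : Real.exp (-(2 * s)) ≤ 1 - s := by
        rw [Real.exp_neg]
        have h1 : 1 + 2 * s ≤ Real.exp (2 * s) := by linarith [Real.add_one_le_exp (2 * s)]
        refine (inv_anti₀ (by positivity) h1).trans ?_
        rw [inv_le_iff_one_le_mul₀ (by positivity)]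
        nlinarith
      have hexp2 : Real.exp (-(2 * y ^ 2 * (1 / n - 1 / ((n : ℝ) + 1)))) ≤ Real.exp (-(2 * s)) := by
        apply Real.exp_le_exp.2
        rw [neg_le_neg_iff, hs]
        have : 1 / ((n : ℝ) + 1) ^ 2 ≤ 1 / n - 1 / ((n : ℝ) + 1) := by
          rw [div_sub_div _ _ hn0.ne' (by positivity), div_le_div_iff₀ (by positivity) (by positivity)]
          nlinarith
        calc 2 * (y ^ 2 / ((n : ℝ) + 1) ^ 2) = 2 * y ^ 2 * (1 / ((n : ℝ) + 1) ^ 2) := by ring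
          _ ≤ _ := by gcongr
      rw [sineProd_succ]
      push_cast
      calc sineProd J y * Real.exp (-(2 * y ^ 2 * (1 / J - 1 / ((n : ℝ) + 1))))
          = sineProd J y * Real.exp (-(2 * y ^ 2 * (1 / J - 1 / n))) *
            Real.exp (-(2 * y ^ 2 * (1 / n - 1 / ((n : ℝ) + 1)))) := by
              rw [mul_assoc (sineProd J y), ← Real.exp_add]; ring_nf
        _ ≤ sineProd n y * |1 - s| := by
              refine mul_le_mul ih ?_ (Real.exp_pos _).le (sineProd_nonneg _ _)
              exact (hexp2.trans hexp).trans (le_abs_self _)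
  have hlim := (Real.tendsto_euler_sin_prod y).abs
  have hle : Real.pi * y * (sineProd J y * Real.exp (-(2 * y ^ 2 / J))) ≤ |Real.sin (Real.pi * y)| := by
    refine ge_of_tendsto hlim (Filter.eventually_atTop.2 ⟨J, fun n hn => ?_⟩)
    rw [abs_mul, abs_of_pos (by positivity : 0 < Real.pi * y), Finset.abs_prod]
    refine mul_le_mul_of_nonneg_left (le_trans ?_ (hlow n hn)) (by positivity)
    refine mul_le_mul_of_nonneg_left (Real.exp_le_exp.2 (neg_le_neg ?_)) (sineProd_nonneg _ _)
    rw [div_eq_mul_one_div (2 * y ^ 2)]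
    have : (0 : ℝ) ≤ 1 / n := by positivity
    exact mul_le_mul_of_nonneg_left (by linarith) (by positivity)
  have h1 := hle.trans (Real.abs_sin_le_one _)
  rw [Real.exp_neg] at h1
  rw [le_div_iff₀ (by positivity)]
  have hE := Real.exp_pos (2 * y ^ 2 / J)
  rw [← mul_assoc, ← div_eq_mul_inv, div_le_one hE] at h1
  linarith

/-- When J < √2·y the tail comparison is unavailable, but y is then O(y²/J) and a crude bound
exponential in y is enough. The constants satisfy (40/3)y ≥ 9y + 2 for y ≥ 3/4. -/
theorem sineProd_le {J : ℕ} (hJ : 1 ≤ J) {y : ℝ} (hy : 3 / 4 ≤ y) :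
    sineProd J y ≤ Real.exp (20 * y ^ 2 / J) / (Real.pi * y) := by
  have hpi := Real.pi_pos
  have hJ0 : (0 : ℝ) < J := by exact_mod_cast hJ
  have hy0 : 0 < y := by linarith
  by_cases hyJ : 2 * y ^ 2 ≤ (J : ℝ) ^ 2
  · refine (sineProd_le_of_small hJ hy0 hyJ).trans ?_
    gcongr
    norm_num
  push Not at hyJ
  have hJy : (J : ℝ) ≤ 3 / 2 * y := by nlinarith
  set m := ⌈y⌉₊ with hm
  have hym : y ≤ m := Nat.le_ceil y
  have hmy : (m : ℝ) < y + 1 := Nat.ceil_lt_add_one hy0.le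
  have h1 : sineProd J y ≤ (∏ i ∈ Finset.range J, (1 + y / ((i : ℝ) + 1))) ^ 2 := by
    rw [← Finset.prod_pow]
    refine Finset.prod_le_prod (fun _ _ => abs_nonneg _) fun i _ => ?_
    have hq : 0 ≤ y / ((i : ℝ) + 1) := by positivity
    rw [← div_pow, abs_le]
    constructor <;> nlinarith
  have h2 : (∏ i ∈ Finset.range J, (1 + y / ((i : ℝ) + 1))) ^ 2 ≤ Real.exp (5 * y + 2) := by
    have h3 := prod_one_add_div_le_two_pow hy0.le hym J
    have h4 : (2 : ℝ) ^ (m + J) ≤ Real.exp ((m : ℝ) + J) := by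
      have : (2 : ℝ) ≤ Real.exp 1 := by linarith [Real.add_one_le_exp (1 : ℝ)]
      calc (2 : ℝ) ^ (m + J) ≤ Real.exp 1 ^ (m + J) := pow_le_pow_left₀ (by norm_num) this _
        _ = _ := by rw [← Real.exp_nat_mul]; push_cast; ring_nf
    calc _ ≤ Real.exp ((m : ℝ) + J) ^ 2 :=
          pow_le_pow_left₀ (Finset.prod_nonneg fun i _ => by positivity) (h3.trans h4) 2
      _ = Real.exp (2 * ((m : ℝ) + J)) := by rw [← Real.exp_nat_mul]; push_cast; rfl
      _ ≤ _ := Real.exp_le_exp.2 (by linarith)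
  rw [le_div_iff₀ (by positivity)]
  have h5 : Real.pi * y ≤ Real.exp (4 * y) := by
    have := Real.add_one_le_exp (4 * y)
    nlinarith [Real.pi_le_four]
  have h6 : 20 / (3 / 2) * y ≤ 20 * y ^ 2 / J := by
    rw [le_div_iff₀ hJ0]
    nlinarith
  calc sineProd J y * (Real.pi * y) ≤ Real.exp (5 * y + 2) * Real.exp (4 * y) :=
        mul_le_mul (h1.trans h2) h5 (by positivity) (Real.exp_pos _).le
    _ = Real.exp (9 * y + 2) := by rw [← Real.exp_add]; ring_nf
    _ ≤ _ := Real.exp_le_exp.2 (by linarith)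

/-! ### The peak function and its Gaussian growth bound -/

/-- The product with roots `-1, …, -2r`. -/
noncomputable def leftProd (r : ℕ) (t : ℝ) : ℝ :=
  ∏ j ∈ Finset.range (2 * r), (1 + t / ((j : ℝ) + 1))

/-- The product with roots `2i + 1/2`, `i = 1, …, r`. -/
noncomputable def rightProd (r : ℕ) (t : ℝ) : ℝ :=
  ∏ i ∈ Finset.range r, (1 - t / (2 * (i : ℝ) + 5 / 2))

theorem leftProd_succ (r : ℕ) (t : ℝ) : leftProd (r + 1) t =
    leftProd r t * ((1 + t / (2 * (r : ℝ) + 1)) * (1 + t / (2 * (r : ℝ) + 2))) := by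
  rw [leftProd, show 2 * (r + 1) = 2 * r + 1 + 1 by ring, Finset.prod_range_succ,
    Finset.prod_range_succ, leftProd, mul_assoc]
  push_cast
  ring_nf

theorem rightProd_succ (r : ℕ) (t : ℝ) :
    rightProd (r + 1) t = rightProd r t * (1 - t / (2 * (r : ℝ) + 5 / 2)) :=
  Finset.prod_range_succ _ _

theorem leftProd_nonneg (r : ℕ) {t : ℝ} (ht : -1 ≤ t) : 0 ≤ leftProd r t := by
  refine Finset.prod_nonneg fun j _ => ?_
  have : -1 ≤ t / ((j : ℝ) + 1) := by
    rw [le_div_iff₀ (by positivity)]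
    have : (0 : ℝ) ≤ j := Nat.cast_nonneg j
    linarith
  linarith

/-- log(1 + y/u) is convex in u, so its value at u + 1/2 is at most the mean of its values at u and
u + 1. -/
theorem rightProd_sq_neg_le (r : ℕ) {y : ℝ} (hy : 0 ≤ y) :
    rightProd r (-y) ^ 2 ≤ ∏ j ∈ Finset.range (2 * r), (1 + y / ((j : ℝ) + 2)) := by
  induction r with
  | zero => simp [rightProd]
  | succ r ih =>
    rw [rightProd_succ, mul_pow, show 2 * (r + 1) = 2 * r + 1 + 1 by ring, Finset.prod_range_succ,
      Finset.prod_range_succ, mul_assoc]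
    refine mul_le_mul ih ?_ (sq_nonneg _) (Finset.prod_nonneg fun j _ => by positivity)
    push_cast
    have hr : (0 : ℝ) ≤ r := Nat.cast_nonneg r
    set u : ℝ := 2 * (r : ℝ) + 2 with hu
    have hu2 : 2 ≤ u := by linarith
    rw [show (2 : ℝ) * r + 1 + 2 = u + 1 by rw [hu]; ring,
      show (2 : ℝ) * r + 5 / 2 = u + 1 / 2 by rw [hu]; ring]
    have h1 : (1 - -y / (u + 1 / 2)) ^ 2 = (y + u + 1 / 2) ^ 2 / (u + 1 / 2) ^ 2 := by
      field_simp; ring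
    have h2 : (1 + y / u) * (1 + y / (u + 1)) = (y + u) * (y + u + 1) / (u * (u + 1)) := by
      field_simp; ring
    rw [h1, h2, div_le_div_iff₀ (by positivity) (by positivity)]
    nlinarith [mul_nonneg hy hy, mul_nonneg hy (by linarith : 0 ≤ u)]

/-- If the factors bounding `rightProd` were 1 + y/(j+1) instead of 1 + y/(j+2), the product would
be exactly `sineProd (2 * r) y`. The shift telescopes to the remaining quotient, whose denominator 1
+ y later helps to absorb the balancing factor. -/
theorem leftProd_mul_rightProd_sq_neg_le (r : ℕ) {y : ℝ} (hy : 0 ≤ y) :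
    |leftProd r (-y)| * rightProd r (-y) ^ 2 ≤
      sineProd (2 * r) y * (1 + y / (2 * r + 1)) / (1 + y) := by
  have htel : ∀ J : ℕ, (∏ j ∈ Finset.range J, (1 + y / ((j : ℝ) + 2))) * (1 + y) =
      (∏ j ∈ Finset.range J, (1 + y / ((j : ℝ) + 1))) * (1 + y / (J + 1)) := by
    intro J
    rw [← Finset.prod_range_succ (fun j : ℕ => 1 + y / ((j : ℝ) + 1)), Finset.prod_range_succ']
    push_cast
    norm_num [add_assoc]
  have hS : |leftProd r (-y)| * ∏ j ∈ Finset.range (2 * r), (1 + y / ((j : ℝ) + 1)) =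
      sineProd (2 * r) y := by
    rw [leftProd, Finset.abs_prod, ← Finset.prod_mul_distrib, sineProd]
    refine Finset.prod_congr rfl fun j _ => ?_
    have : 0 ≤ 1 + y / ((j : ℝ) + 1) := by positivity
    rw [← abs_of_nonneg this, ← abs_mul]
    congr 1
    field_simp
    ring
  rw [le_div_iff₀ (by positivity), ← hS]
  calc _ ≤ |leftProd r (-y)| * (∏ j ∈ Finset.range (2 * r), (1 + y / ((j : ℝ) + 2))) * (1 + y) := by
        gcongr
        exact rightProd_sq_neg_le r hy
    _ = _ := by
        have := htel (2 * r)
        push_cast at this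
        rw [mul_assoc, this, mul_assoc]

/-- Put z = t - 1/2 and u = 2r + 2. Two consecutive left factors have numerator (z+u)² - 1/4 and the
double right factor has numerator (u-z)², so together they are dominated by (1 - z²/u²)² times a
Wallis factor. This is why the double roots sit at 2i + 1/2. -/
theorem leftProd_mul_rightProd_sq_le (r : ℕ) {t : ℝ} (ht : 0 ≤ t) :
    leftProd r t * rightProd r t ^ 2 ≤ Real.Wallis.W r * sineProd r ((t - 1 / 2) / 2) ^ 2 := by
  induction r with
  | zero => simp [leftProd, rightProd, Real.Wallis.W, sineProd]
  | succ r ih =>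
    have hr : (0 : ℝ) ≤ r := Nat.cast_nonneg r
    rw [leftProd_succ, rightProd_succ, Real.Wallis.W_succ, sineProd_succ, mul_pow, mul_pow, sq_abs]
    set u : ℝ := 2 * (r : ℝ) + 2 with hu
    have hu2 : 2 ≤ u := by linarith
    rw [show (2 : ℝ) * r + 1 = u - 1 by rw [hu]; ring, show (2 : ℝ) * r + 3 = u + 1 by rw [hu]; ring,
      show (2 : ℝ) * r + 5 / 2 = u + 1 / 2 by rw [hu]; ring,
      show (r : ℝ) + 1 = u / 2 by rw [hu]; ring]
    set z := t - 1 / 2 with hz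
    have htz : t = z + 1 / 2 := by rw [hz]; ring
    have hu1 : 0 < u - 1 := by linarith
    have hfac : (1 + t / (u - 1)) * (1 + t / u) * (1 - t / (u + 1 / 2)) ^ 2 ≤
        u / (u - 1) * (u / (u + 1)) * (1 - (z / 2) ^ 2 / (u / 2) ^ 2) ^ 2 := by
      have h1 : (1 + t / (u - 1)) * (1 + t / u) * (1 - t / (u + 1 / 2)) ^ 2 =
          (((z + u) ^ 2 - 1 / 4) * (u - z) ^ 2) / ((u - 1) * (u * (u + 1 / 2) ^ 2)) := by
        rw [htz]; field_simp; ring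
      have h2 : u / (u - 1) * (u / (u + 1)) * (1 - (z / 2) ^ 2 / (u / 2) ^ 2) ^ 2 =
          ((z + u) ^ 2 * (u - z) ^ 2) / ((u - 1) * (u * (u * (u + 1)))) := by
        field_simp; ring
      rw [h1, h2]
      gcongr
      · linarith
      · nlinarith
    calc _ = leftProd r t * rightProd r t ^ 2 *
          ((1 + t / (u - 1)) * (1 + t / u) * (1 - t / (u + 1 / 2)) ^ 2) := by ring
      _ ≤ Real.Wallis.W r * sineProd r (z / 2) ^ 2 *
          (u / (u - 1) * (u / (u + 1)) * (1 - (z / 2) ^ 2 / (u / 2) ^ 2) ^ 2) := by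
          refine mul_le_mul ih hfac ?_ (mul_nonneg (Real.Wallis.W_pos r).le (sq_nonneg _))
          positivity
      _ = _ := by ring

/-- The ratio of the values at `1` and `0` of the product with simple roots `-1, …, -2r` and
double roots `2i + 1/2`. -/
noncomputable def balanceRatio (r : ℕ) : ℝ :=
  leftProd r 1 * rightProd r 1 ^ 2

/-- Each new factor lies between 1 and the corresponding Wallis factor. As the Wallis products are
at most π/2, the balancing slope lies in [0, 1/3]. -/
theorem balanceRatio_bounds (r : ℕ) : 1 ≤ balanceRatio r ∧ balanceRatio r ≤ Real.Wallis.W r := by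
  induction r with
  | zero => simp [balanceRatio, leftProd, rightProd, Real.Wallis.W]
  | succ r ih =>
    have hr : (0 : ℝ) ≤ r := Nat.cast_nonneg r
    have hsucc : balanceRatio (r + 1) = balanceRatio r * ((1 + 1 / (2 * (r : ℝ) + 1)) *
        (1 + 1 / (2 * (r : ℝ) + 2)) * (1 - 1 / (2 * (r : ℝ) + 5 / 2)) ^ 2) := by
      rw [balanceRatio, leftProd_succ, rightProd_succ, balanceRatio]; ring
    have heq : (1 + 1 / (2 * (r : ℝ) + 1)) * (1 + 1 / (2 * (r : ℝ) + 2)) *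
        (1 - 1 / (2 * (r : ℝ) + 5 / 2)) ^ 2 =
        ((2 * r + 3) * (2 * r + 3 / 2) ^ 2) / ((2 * r + 1) * (2 * r + 5 / 2) ^ 2) := by
      field_simp; ring
    have h1 : 1 ≤ ((2 * (r : ℝ) + 3) * (2 * r + 3 / 2) ^ 2) / ((2 * r + 1) * (2 * r + 5 / 2) ^ 2) := by
      rw [one_le_div (by positivity)]; nlinarith
    have h2 : ((2 * (r : ℝ) + 3) * (2 * r + 3 / 2) ^ 2) / ((2 * r + 1) * (2 * r + 5 / 2) ^ 2) ≤
        (2 * r + 2) / (2 * r + 1) * ((2 * r + 2) / (2 * r + 3)) := by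
      rw [div_mul_div_comm, div_le_div_iff₀ (by positivity) (by positivity)]
      have h3 : (2 * (r : ℝ) + 3) * (2 * r + 3 / 2) ≤ (2 * r + 2) * (2 * r + 5 / 2) := by nlinarith
      have h4 := pow_le_pow_left₀ (by positivity) h3 2
      have h5 := mul_le_mul_of_nonneg_left h4 (by positivity : 0 ≤ 2 * (r : ℝ) + 1)
      linarith
    rw [hsucc, heq, Real.Wallis.W_succ]
    refine ⟨?_, mul_le_mul ih.2 h2 (by positivity) (Real.Wallis.W_pos r).le⟩
    nlinarith [ih.1]

/-- The number `γ` with `ρ * (1 - γ) ^ 2 = 1`. -/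
noncomputable def balanceSlope (ρ : ℝ) : ℝ :=
  1 - 1 / Real.sqrt ρ

theorem mul_one_sub_balanceSlope_sq {ρ : ℝ} (hρ : 0 < ρ) : ρ * (1 - balanceSlope ρ) ^ 2 = 1 := by
  rw [balanceSlope, sub_sub_cancel, div_pow, Real.sq_sqrt hρ.le, one_pow, mul_one_div_cancel hρ.ne']

theorem balanceSlope_nonneg {ρ : ℝ} (hρ : 1 ≤ ρ) : 0 ≤ balanceSlope ρ := by
  have : 1 ≤ Real.sqrt ρ := Real.one_le_sqrt.2 hρ
  rw [balanceSlope, sub_nonneg, div_le_one (by linarith)]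
  exact this

theorem balanceSlope_lt_one {ρ : ℝ} (hρ : 0 < ρ) : balanceSlope ρ < 1 := by
  have : 0 < 1 / Real.sqrt ρ := by positivity
  rw [balanceSlope]; linarith

/-- A function equal to `1` at `0` and `1` with roots `-1, …, -2r` and all its other roots
double and greater than `1`. -/
noncomputable def peak (r : ℕ) (t : ℝ) : ℝ :=
  leftProd r t * rightProd r t ^ 2 * (1 - balanceSlope (balanceRatio r) * t) ^ 2

theorem balanceRatio_pos (r : ℕ) : 0 < balanceRatio r :=
  one_pos.trans_le (balanceRatio_bounds r).1

theorem balanceSlope_balanceRatio_nonneg (r : ℕ) : 0 ≤ balanceSlope (balanceRatio r) :=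
  balanceSlope_nonneg (balanceRatio_bounds r).1

theorem balanceSlope_balanceRatio_le (r : ℕ) : balanceSlope (balanceRatio r) ≤ 1 / 3 := by
  have h1 := (balanceRatio_bounds r).2.trans (Real.Wallis.W_le r)
  have h2 : Real.sqrt (balanceRatio r) ≤ 3 / 2 := by
    rw [Real.sqrt_le_left (by norm_num)]
    linarith [Real.pi_le_four]
  have h3 : 0 < Real.sqrt (balanceRatio r) := Real.sqrt_pos.2 (balanceRatio_pos r)
  have h4 : 1 / (3 / 2) ≤ 1 / Real.sqrt (balanceRatio r) := one_div_le_one_div_of_le h3 h2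
  rw [balanceSlope]
  linarith

theorem leftProd_zero_right (r : ℕ) : leftProd r 0 = 1 := by simp [leftProd]

theorem rightProd_zero_right (r : ℕ) : rightProd r 0 = 1 := by simp [rightProd]

theorem peak_zero (r : ℕ) : peak r 0 = 1 := by
  simp [peak, leftProd_zero_right, rightProd_zero_right]

theorem peak_one (r : ℕ) : peak r 1 = 1 := by
  rw [peak, mul_one]
  exact mul_one_sub_balanceSlope_sq (balanceRatio_pos r)

/-- The interval is free of roots: the nearest are -1 and 5/2, and the balancing factor can vanish
only at a point at least 3. -/
theorem logConcaveOn_peak (r : ℕ) : LogConcaveOn (Set.Ioo (-1) (5 / 2)) (peak r) := by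
  have hI : Convex ℝ (Set.Ioo (-1 : ℝ) (5 / 2)) := convex_Ioo _ _
  have hL : LogConcaveOn (Set.Ioo (-1) (5 / 2)) (leftProd r) := by
    have := LogConcaveOn.prod hI (Finset.range (2 * r))
      (fun j x => 1 + (1 / ((j : ℝ) + 1)) * x) fun j _ => LogConcaveOn.affine hI fun x hx => by
        have hj : (0 : ℝ) ≤ j := Nat.cast_nonneg j
        rw [one_div_mul_eq_div]
        have : -1 < x / ((j : ℝ) + 1) := by
          rw [lt_div_iff₀ (by positivity)]; linarith [hx.1]
        linarith
    convert this using 2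
    simp only [leftProd, one_div_mul_eq_div]
  have hR : LogConcaveOn (Set.Ioo (-1) (5 / 2)) (rightProd r) := by
    have := LogConcaveOn.prod hI (Finset.range r)
      (fun j x => 1 + (-(1 / (2 * (j : ℝ) + 5 / 2))) * x) fun j _ => LogConcaveOn.affine hI
        fun x hx => by
          have hj : (0 : ℝ) ≤ j := Nat.cast_nonneg j
          rw [neg_mul, one_div_mul_eq_div]
          have : x / (2 * (j : ℝ) + 5 / 2) < 1 := by
            rw [div_lt_one (by positivity)]; linarith [hx.2]
          linarith
    convert this using 2
    simp only [rightProd, neg_mul, one_div_mul_eq_div, sub_eq_add_neg]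
  have hS : LogConcaveOn (Set.Ioo (-1) (5 / 2))
      fun x => 1 + (-balanceSlope (balanceRatio r)) * x := LogConcaveOn.affine hI fun x hx => by
    have h1 := balanceSlope_balanceRatio_le r
    have h2 := balanceSlope_balanceRatio_nonneg r
    have : balanceSlope (balanceRatio r) * x ≤ balanceSlope (balanceRatio r) * (5 / 2) :=
      mul_le_mul_of_nonneg_left hx.2.le h2
    linarith
  have := (hL.mul (hR.pow hI 2)).mul (hS.pow hI 2)
  change LogConcaveOn _ fun x => leftProd r x * rightProd r x ^ 2 *
    (1 - balanceSlope (balanceRatio r) * x) ^ 2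
  simpa only [neg_mul, ← sub_eq_add_neg] using this

theorem one_le_peak (r : ℕ) {t : ℝ} (h0 : 0 ≤ t) (h1 : t ≤ 1) : 1 ≤ peak r t := by
  rw [← peak_zero r]
  exact (logConcaveOn_peak r).le_of_mem_Icc (v := 1) (by norm_num) (by norm_num)
    (by rw [peak_zero, peak_one]) h0 h1

theorem abs_peak_le_one (r : ℕ) {t : ℝ} (h0 : -1 < t) (h1 : t < 5 / 2) (ht : t ≤ 0 ∨ 1 ≤ t) :
    |peak r t| ≤ 1 := by
  have hLC := logConcaveOn_peak r
  have heq : peak r 0 = peak r 1 := by rw [peak_zero, peak_one]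
  rw [abs_of_pos (hLC.1 t ⟨h0, h1⟩), ← peak_zero r]
  rcases ht with ht | ht
  · exact hLC.le_of_le_left (v := 1) ⟨h0, h1⟩ (by norm_num) heq ht one_pos
  · exact hLC.le_of_le_right (v := 1) (by norm_num) ⟨h0, h1⟩ heq ht one_pos

/-- The sine product and the telescoped quotient supply 1/(πy(1+y)), which outweighs (1 + y/3)²; no
constant above 1 is left in front of the exponential. -/
theorem abs_peak_neg_le {r : ℕ} (hr : 1 ≤ r) {y : ℝ} (hy : 1 ≤ y) :
    |peak r (-y)| ≤ Real.exp (11 * y ^ 2 / r) := by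
  have hr0 : (1 : ℝ) ≤ r := by exact_mod_cast hr
  have hγ0 := balanceSlope_balanceRatio_nonneg r
  have hγ1 := balanceSlope_balanceRatio_le r
  set γ := balanceSlope (balanceRatio r) with hγ
  have hpi := Real.pi_gt_three
  have hS := sineProd_le (J := 2 * r) (by omega) (y := y) (by linarith)
  have hA := leftProd_mul_rightProd_sq_neg_le r (y := y) (by linarith)
  have hE : Real.exp (20 * y ^ 2 / ((2 * r : ℕ) : ℝ)) = Real.exp (10 * y ^ 2 / r) := by
    congr 1; push_cast; field_simp; norm_num
  rw [hE] at hS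
  have h1 : 1 + y / (2 * r + 1) ≤ Real.exp (y ^ 2 / r) := by
    refine le_trans ?_ (Real.add_one_le_exp _)
    have : y / (2 * r + 1) ≤ y ^ 2 / r := by gcongr <;> nlinarith
    linarith
  have h2 : (1 - γ * -y) ^ 2 ≤ (1 + y / 3) ^ 2 := by
    apply pow_le_pow_left₀ <;> nlinarith
  have habs : |peak r (-y)| = |leftProd r (-y)| * rightProd r (-y) ^ 2 * (1 - γ * -y) ^ 2 := by
    rw [peak, abs_mul, abs_mul, abs_of_nonneg (sq_nonneg (rightProd r (-y))),
      abs_of_nonneg (sq_nonneg (1 - γ * -y))]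
  rw [habs]
  calc _ ≤ (Real.exp (10 * y ^ 2 / r) / (Real.pi * y) * Real.exp (y ^ 2 / r) / (1 + y)) *
        (1 + y / 3) ^ 2 := by
          refine mul_le_mul (hA.trans ?_) h2 (sq_nonneg _) (by positivity)
          gcongr
    _ = Real.exp (11 * y ^ 2 / r) * ((1 + y / 3) ^ 2 / (Real.pi * y * (1 + y))) := by
          rw [show 11 * y ^ 2 / r = 10 * y ^ 2 / r + y ^ 2 / (r : ℝ) by ring, Real.exp_add]
          field_simp
    _ ≤ Real.exp (11 * y ^ 2 / r) * 1 := by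
          gcongr
          rw [div_le_one (by positivity)]
          have : 3 * (y * (1 + y)) ≤ Real.pi * (y * (1 + y)) := by gcongr
          nlinarith
    _ = _ := mul_one _

theorem abs_peak_le_of_two_le {r : ℕ} (hr : 1 ≤ r) {t : ℝ} (ht : 2 ≤ t) :
    |peak r t| ≤ Real.exp (12 * (t * (t - 1)) / r) := by
  have hr0 : (1 : ℝ) ≤ r := by exact_mod_cast hr
  have hγ0 := balanceSlope_balanceRatio_nonneg r
  have hγ1 := balanceSlope_balanceRatio_le r
  set γ := balanceSlope (balanceRatio r) with hγ
  have hpi := Real.pi_gt_three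
  set u := (t - 1 / 2) / 2 with hu
  have hu1 : 3 / 4 ≤ u := by rw [hu]; linarith
  have hS := sineProd_le hr hu1
  have hA := leftProd_mul_rightProd_sq_le r (t := t) (by linarith)
  rw [← hu] at hA
  have hW := Real.Wallis.W_le r
  -- Uses 0 ≤ γ ≤ 1/3; equality holds at t = 2, γ = 0. Against the factor (πu)⁻² and the Wallis
  -- bound π/2 this leaves 8/(9π) < 1.
  have h2 : (1 - γ * t) ^ 2 ≤ (4 / 3 * u) ^ 2 := by
    apply sq_le_sq'
    · rw [hu]; nlinarith
    · rw [hu]; nlinarith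
  have habs : |peak r t| = leftProd r t * rightProd r t ^ 2 * (1 - γ * t) ^ 2 := by
    have := leftProd_nonneg r (t := t) (by linarith)
    rw [peak, abs_of_nonneg (by positivity)]
  rw [habs]
  calc _ ≤ (Real.pi / 2 * (Real.exp (20 * u ^ 2 / r) / (Real.pi * u)) ^ 2) * (4 / 3 * u) ^ 2 := by
          refine mul_le_mul (hA.trans ?_) h2 (sq_nonneg _) (by positivity)
          refine mul_le_mul hW (pow_le_pow_left₀ (sineProd_nonneg _ _) hS 2) (sq_nonneg _)
            (by positivity)
    _ = Real.exp (40 * u ^ 2 / r) * (8 / (9 * Real.pi)) := by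
          rw [show 40 * u ^ 2 / r = 20 * u ^ 2 / r + 20 * u ^ 2 / (r : ℝ) by ring, Real.exp_add]
          field_simp
          norm_num
    _ ≤ Real.exp (40 * u ^ 2 / r) * 1 := by
          gcongr
          rw [div_le_one (by positivity)]
          linarith
    _ ≤ _ := by
          rw [mul_one, Real.exp_le_exp, hu]
          exact div_le_div_of_nonneg_right (by nlinarith) (by linarith)

theorem abs_peak_le {r : ℕ} (hr : 1 ≤ r) {t : ℝ} (ht : t ≤ 0 ∨ 1 ≤ t) :
    |peak r t| ≤ Real.exp (12 * (t * (t - 1)) / r) := by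
  have hr0 : (1 : ℝ) ≤ r := by exact_mod_cast hr
  have hone : (1 : ℝ) ≤ Real.exp (12 * (t * (t - 1)) / r) := by
    apply Real.one_le_exp
    have : 0 ≤ t * (t - 1) := by rcases ht with h | h <;> nlinarith
    positivity
  by_cases h2 : 2 ≤ t
  · exact abs_peak_le_of_two_le hr h2
  by_cases h1 : t ≤ -1
  · have := abs_peak_neg_le hr (y := -t) (by linarith)
    rw [neg_neg] at this
    refine this.trans (Real.exp_le_exp.2 ?_)
    exact div_le_div_of_nonneg_right (by nlinarith) (by linarith)
  · exact (abs_peak_le_one r (by linarith) (by linarith) ht).trans hone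

/-! ### The compensating cubic -/

/-- A cubic equal to `1` at `0` and `1`, with a root at `-R`. -/
noncomputable def bump (R t : ℝ) : ℝ :=
  (1 + t / R) * (1 - balanceSlope (1 + 1 / R) * t) ^ 2

/-- The cubic minus 1 vanishes at 0 and 1, so the cofactor δ is affine. It is nonincreasing in t,
hence only t = 2R has to be checked. -/
theorem exists_bump_eq {R : ℝ} (hR : 1 ≤ R) (t : ℝ) :
    ∃ δ, bump R t = 1 - t * (t - 1) * δ ∧ (t ≤ 2 * R → 1 / (8 * R ^ 2) ≤ δ) := by
  have hR0 : 0 < R := by linarith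
  have hρ : 0 < 1 + 1 / R := by positivity
  have hρ1 : 1 ≤ 1 + 1 / R := le_add_of_nonneg_right (by positivity)
  have hbal := mul_one_sub_balanceSlope_sq hρ
  have hγ1 := balanceSlope_lt_one hρ
  have hγ0 := balanceSlope_nonneg hρ1
  rw [bump]
  set γ := balanceSlope (1 + 1 / R) with hγ
  have hbal' : (R + 1) * (1 - γ) ^ 2 = R := by
    field_simp at hbal
    linarith
  refine ⟨(1 - 2 * γ * R - γ ^ 2 * t) / R, ?_, fun ht => ?_⟩
  · field_simp
    linear_combination t ^ 2 * hbal'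
  · obtain ⟨g, hg⟩ : ∃ g, g = 1 - γ := ⟨_, rfl⟩
    have hγg : γ = 1 - g := by rw [hg]; ring
    rw [← hg] at hbal'
    have hg0 : 0 < g := by linarith
    have hg1 : g ≤ 1 := by linarith
    have hRg : R * (1 - g ^ 2) = g ^ 2 := by linarith
    have hg2 : 1 / 2 ≤ g ^ 2 := by nlinarith
    have hg3 : 7 / 10 ≤ g := by nlinarith
    have hglt : 0 < 1 - g ^ 2 := by
      by_contra h
      push Not at h
      nlinarith
    -- Since γ is about 1/(2R), the terms 1 and 2γR nearly cancel. The relation R(1-g²) = g² makes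
    -- the cancellation exact and exposes the small factor 1 - g.
    have hfac : (1 - 2 * γ * R - γ ^ 2 * (2 * R)) * (1 + g) = (1 - g) * (1 + 2 * g - 2 * g ^ 2) := by
      have h1 : 0 < 1 - g := by nlinarith
      apply mul_right_cancel₀ h1.ne'
      rw [hγg]
      linear_combination (-2 * (1 - g) - 2 * (1 - g) ^ 2) * hRg
    have hkey : 1 / (8 * R) ≤ 1 - 2 * γ * R - γ ^ 2 * (2 * R) := by
      rw [div_le_iff₀ (by positivity)]
      have h1 : (1 - g) ≤ (1 - 2 * γ * R - γ ^ 2 * (2 * R)) * (1 + g) := by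
        rw [hfac]
        nlinarith
      have h2 : (1 - g) * (8 * R) ≤ (1 - 2 * γ * R - γ ^ 2 * (2 * R)) * (8 * R) * (1 + g) := by
        have := mul_le_mul_of_nonneg_right h1 (by positivity : 0 ≤ 8 * R)
        linarith
      have h3 : (1 + g) ≤ (1 - g) * (8 * R) := by
        have : (1 + g) * (1 + g) ≤ (1 - g) * (8 * R) * (1 + g) := by nlinarith
        exact le_of_mul_le_mul_right this (by linarith)
      have h4 : 1 * (1 + g) ≤ (1 - 2 * γ * R - γ ^ 2 * (2 * R)) * (8 * R) * (1 + g) := by linarith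
      exact le_of_mul_le_mul_right h4 (by linarith)
    rw [le_div_iff₀ hR0]
    have h5 : γ ^ 2 * t ≤ γ ^ 2 * (2 * R) := by gcongr
    calc 1 / (8 * R ^ 2) * R = 1 / (8 * R) := by field_simp
      _ ≤ _ := by linarith

theorem one_le_bump {R : ℝ} (hR : 1 ≤ R) {t : ℝ} (h0 : 0 ≤ t) (h1 : t ≤ 1) : 1 ≤ bump R t := by
  obtain ⟨δ, hδ, hle⟩ := exists_bump_eq hR t
  have h2 := hle (by linarith)
  have : 0 ≤ δ := le_trans (by positivity) h2
  rw [hδ]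
  nlinarith [mul_nonneg (mul_nonneg h0 (sub_nonneg.2 h1)) this]

theorem bump_nonneg {R : ℝ} (hR : 1 ≤ R) {t : ℝ} (h : -R ≤ t) : 0 ≤ bump R t := by
  have : 0 ≤ 1 + t / R := by
    have : -1 ≤ t / R := by rw [le_div_iff₀ (by linarith)]; linarith
    linarith
  exact mul_nonneg this (sq_nonneg _)

theorem bump_le_exp {R : ℝ} (hR : 1 ≤ R) {t : ℝ} (h : t ≤ 2 * R) (ht : t ≤ 0 ∨ 1 ≤ t) :
    bump R t ≤ Real.exp (-(t * (t - 1) / (8 * R ^ 2))) := by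
  obtain ⟨δ, hδ, hle⟩ := exists_bump_eq hR t
  have h2 := hle h
  have h3 : 0 ≤ t * (t - 1) := by rcases ht with h | h <;> nlinarith
  have h4 := mul_le_mul_of_nonneg_left h2 h3
  rw [hδ]
  have := Real.add_one_le_exp (-(t * (t - 1) / (8 * R ^ 2)))
  have h5 : t * (t - 1) * (1 / (8 * R ^ 2)) = t * (t - 1) / (8 * R ^ 2) := by ring
  linarith

/-! ### Growth far to the right, and cancellation between the factors -/

/-- Past a threshold T, a factor 1 + t/c costs at most t/T times its value at T, which reduces
growth estimates for t ≥ T to the single point T. -/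
theorem one_add_le_scale {t T a b : ℝ} (hT : 0 < T) (hTt : T ≤ t) (ha : a ≤ t / T * b) :
    1 + a ≤ t / T * (1 + b) := by
  have : 1 ≤ t / T := (one_le_div hT).2 hTt
  linarith

theorem prod_one_add_div_scale {t : ℝ} {T : ℕ} (hT : 0 < T) (hTt : (T : ℝ) ≤ t) (J : ℕ) :
    ∏ i ∈ Finset.range J, (1 + t / ((i : ℝ) + 1)) ≤ (t / T) ^ J * 2 ^ (T + J) := by
  have hT0 : (0 : ℝ) < T := by exact_mod_cast hT
  have ht : 0 < t := hT0.trans_le hTt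
  calc _ ≤ ∏ i ∈ Finset.range J, (t / T * (1 + (T : ℝ) / ((i : ℝ) + 1))) := by
        refine Finset.prod_le_prod (fun i _ => by positivity) fun i _ => ?_
        exact one_add_le_scale hT0 hTt (le_of_eq (by field_simp))
    _ = (t / T) ^ J * ∏ i ∈ Finset.range J, (1 + (T : ℝ) / ((i : ℝ) + 1)) := by
        rw [Finset.prod_mul_distrib, Finset.prod_const, Finset.card_range]
    _ ≤ _ := by
        gcongr
        exact prod_one_add_div_le_two_pow hT0.le le_rfl J

theorem abs_peak_growth (r : ℕ) {t : ℝ} {T : ℕ} (hT : 0 < T) (hTt : (T : ℝ) ≤ t) :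
    |peak r t| ≤ (t / T) ^ (4 * r + 2) * 2 ^ (5 * T + 4 * r) := by
  have hT0 : (0 : ℝ) < T := by exact_mod_cast hT
  have ht : 0 < t := hT0.trans_le hTt
  have hγ0 := balanceSlope_balanceRatio_nonneg r
  have hγ1 := balanceSlope_balanceRatio_le r
  set γ := balanceSlope (balanceRatio r) with hγ
  have hL : |leftProd r t| ≤ (t / T) ^ (2 * r) * 2 ^ (T + 2 * r) := by
    rw [abs_of_nonneg (leftProd_nonneg r (by linarith))]
    exact prod_one_add_div_scale hT hTt (2 * r)
  have hR : |rightProd r t| ≤ (t / T) ^ r * 2 ^ (T + r) := by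
    refine le_trans ?_ (prod_one_add_div_scale hT hTt r)
    rw [rightProd, Finset.abs_prod]
    refine Finset.prod_le_prod (fun _ _ => abs_nonneg _) fun i _ => ?_
    have h1 : t / (2 * (i : ℝ) + 5 / 2) ≤ t / ((i : ℝ) + 1) := by
      gcongr
      · have : (0 : ℝ) ≤ i := Nat.cast_nonneg i
        linarith
      · norm_num
    have h0 : 0 ≤ t / (2 * (i : ℝ) + 5 / 2) := by positivity
    rw [abs_le]
    constructor <;> linarith
  have hS : |1 - γ * t| ≤ t / T * 2 ^ T := by
    have h1 : |1 - γ * t| ≤ 1 + t := by rw [abs_le]; constructor <;> nlinarith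
    have h2 : 1 + t ≤ t / T * (1 + T) :=
      one_add_le_scale hT0 hTt (le_of_eq (by field_simp))
    have h3 : 1 + (T : ℝ) ≤ 2 ^ T := by
      have : T + 1 ≤ 2 ^ T := Nat.lt_two_pow_self
      rw [add_comm]
      exact_mod_cast this
    exact h1.trans (h2.trans (by gcongr))
  rw [peak, abs_mul, abs_mul, abs_pow, abs_pow]
  calc _ ≤ ((t / T) ^ (2 * r) * 2 ^ (T + 2 * r)) * ((t / T) ^ r * 2 ^ (T + r)) ^ 2 *
        (t / T * 2 ^ T) ^ 2 := by gcongr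
    _ = _ := by ring

theorem bump_growth {R t : ℝ} (hR : 1 ≤ R) (ht : 2 * R ≤ t) :
    bump R t ≤ (t / (2 * R)) ^ 3 * 2 ^ 5 := by
  have hR0 : 0 < R := by linarith
  have ht0 : 0 < t := by linarith
  have hρ1 : 1 ≤ 1 + 1 / R := le_add_of_nonneg_right (by positivity)
  have hγ0 := balanceSlope_nonneg hρ1
  have hγ1 : balanceSlope (1 + 1 / R) ≤ 1 / R := by
    have hs : 1 ≤ Real.sqrt (1 + 1 / R) := Real.one_le_sqrt.2 hρ1
    have hsq : Real.sqrt (1 + 1 / R) ^ 2 = 1 + 1 / R := Real.sq_sqrt (by linarith)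
    have h1 : 1 - 1 / R ≤ 1 / Real.sqrt (1 + 1 / R) := by
      rw [le_div_iff₀ (by linarith)]
      have h2 : (1 - 1 / R) * Real.sqrt (1 + 1 / R) ≤ 1 := by
        by_cases h3 : 1 - 1 / R ≤ 0
        · have := mul_nonpos_of_nonpos_of_nonneg h3 (by linarith : 0 ≤ Real.sqrt (1 + 1 / R))
          linarith
        · push Not at h3
          have h4 : Real.sqrt (1 + 1 / R) ≤ 1 + 1 / R := by nlinarith
          nlinarith [sq_nonneg (1 / R)]
      exact h2
    rw [balanceSlope]; linarith
  rw [bump]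
  set γ := balanceSlope (1 + 1 / R) with hγ
  have h1 : 1 + t / R ≤ t / (2 * R) * (1 + 2) :=
    one_add_le_scale (by linarith) ht (le_of_eq (by field_simp))
  have h2 : (1 - γ * t) ^ 2 ≤ (t / (2 * R) * (1 + 2)) ^ 2 := by
    have h3 : γ * t ≤ t / R := by
      calc γ * t ≤ 1 / R * t := by gcongr
        _ = t / R := by ring
    have h4 : 0 ≤ γ * t := by positivity
    apply sq_le_sq' <;> linarith
  calc _ ≤ (t / (2 * R) * (1 + 2)) * (t / (2 * R) * (1 + 2)) ^ 2 :=
        mul_le_mul h1 h2 (sq_nonneg _) (by positivity)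
    _ = (t / (2 * R)) ^ 3 * 27 := by ring
    _ ≤ _ := by gcongr; norm_num

/-- N = 96R²/k is the number of copies for which N/(8R²) = 12/k, so the two exponentials are
reciprocal. -/
theorem peak_mul_bump_pow_le_one {k N : ℕ} (hk : 1 ≤ k) {R t : ℝ} (hR : 1 ≤ R)
    (hN : (N : ℝ) * k = 96 * R ^ 2) (h1 : -R ≤ t) (h2 : t ≤ 2 * R) (ht : t ≤ 0 ∨ 1 ≤ t) :
    |peak k t| * bump R t ^ N ≤ 1 := by
  have hk0 : (0 : ℝ) < k := by exact_mod_cast hk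
  have hb : bump R t ^ N ≤ Real.exp (-(12 * (t * (t - 1)) / k)) := by
    calc bump R t ^ N ≤ Real.exp (-(t * (t - 1) / (8 * R ^ 2))) ^ N :=
          pow_le_pow_left₀ (bump_nonneg hR h1) (bump_le_exp hR h2 ht) N
      _ = _ := by
          rw [← Real.exp_nat_mul]
          congr 1
          have hR2 : R ^ 2 = N * k / 96 := by linarith
          have hN0 : (N : ℝ) ≠ 0 := by
            intro h0
            rw [h0] at hN
            nlinarith
          rw [hR2]
          field_simp
          ring
  calc _ ≤ Real.exp (12 * (t * (t - 1)) / k) * Real.exp (-(12 * (t * (t - 1)) / k)) :=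
        mul_le_mul (abs_peak_le hk ht) hb (pow_nonneg (bump_nonneg hR h1) N) (Real.exp_pos _).le
    _ = 1 := by rw [← Real.exp_add, add_neg_cancel, Real.exp_zero]

/-- With y = t/T ≥ 1, the first two factors are at most y^A·2^B with A, B ≤ L, while |v| ≤ 1/(2y).
-/
theorem peak_mul_bump_pow_growth {k N L T : ℕ} (hT : 0 < T) {R t v : ℝ} (hR : 1 ≤ R)
    (hTR : (T : ℝ) = 2 * R) (ht : (T : ℝ) ≤ t) (hL1 : 4 * k + 2 + 3 * N ≤ L)
    (hL2 : 5 * T + 4 * k + 5 * N ≤ L) (hv : |v| ≤ T / t / 2) :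
    |peak k t| * bump R t ^ N * |v| ^ L ≤ 1 := by
  have hT0 : (0 : ℝ) < T := by exact_mod_cast hT
  have ht0 : 0 < t := hT0.trans_le ht
  have hy : 1 ≤ t / T := (one_le_div hT0).2 ht
  have hp := abs_peak_growth k hT ht
  have hb := bump_growth hR (t := t) (by linarith)
  rw [← hTR] at hb
  have hb0 : 0 ≤ bump R t := bump_nonneg hR (by linarith)
  set y := t / T with hy_def
  have hv' : |v| ≤ (y * 2)⁻¹ := by
    refine hv.trans (le_of_eq ?_)
    rw [hy_def]; field_simp
  have h1 : |peak k t| * bump R t ^ N ≤ (y * 2) ^ L := by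
    calc _ ≤ (y ^ (4 * k + 2) * 2 ^ (5 * T + 4 * k)) * (y ^ 3 * 2 ^ 5) ^ N := by gcongr
      _ = y ^ (4 * k + 2 + 3 * N) * 2 ^ (5 * T + 4 * k + 5 * N) := by
          rw [mul_pow, ← pow_mul, ← pow_mul, pow_add y, pow_add 2 (5 * T + 4 * k)]; ring
      _ ≤ y ^ L * 2 ^ L := by
          gcongr
          · norm_num
      _ = _ := (mul_pow _ _ _).symm
  calc _ ≤ (y * 2) ^ L * ((y * 2)⁻¹) ^ L := by gcongr
    _ = 1 := by rw [← mul_pow, mul_inv_cancel₀ (by positivity), one_pow]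

/-! ### Assembling the certificate -/

/-- `f` is the function of a real polynomial of degree at most `d`. -/
def IsPolynomialFunction (d : ℕ) (f : ℝ → ℝ) : Prop :=
  ∃ p : Polynomial ℝ, p.natDegree ≤ d ∧ ∀ x, p.eval x = f x

theorem IsPolynomialFunction.mul {a b : ℕ} {f g : ℝ → ℝ} (hf : IsPolynomialFunction a f)
    (hg : IsPolynomialFunction b g) : IsPolynomialFunction (a + b) fun x => f x * g x := by
  obtain ⟨p, hp, hpf⟩ := hf
  obtain ⟨q, hq, hqg⟩ := hg
  exact ⟨p * q, Polynomial.natDegree_mul_le.trans (add_le_add hp hq), fun x => by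
    rw [Polynomial.eval_mul, hpf, hqg]⟩

theorem IsPolynomialFunction.pow {a : ℕ} {f : ℝ → ℝ} (hf : IsPolynomialFunction a f) (m : ℕ) :
    IsPolynomialFunction (m * a) fun x => f x ^ m := by
  obtain ⟨p, hp, hpf⟩ := hf
  exact ⟨p ^ m, Polynomial.natDegree_pow_le.trans (Nat.mul_le_mul_left m hp), fun x => by
    rw [Polynomial.eval_pow, hpf]⟩

theorem IsPolynomialFunction.affine (a b : ℝ) : IsPolynomialFunction 1 fun x => a + b * x :=
  ⟨Polynomial.C a + Polynomial.C b * Polynomial.X, by compute_degree, fun x => by simp⟩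

theorem IsPolynomialFunction.prod (m : ℕ) (f : ℕ → ℝ → ℝ)
    (hf : ∀ i, IsPolynomialFunction 1 (f i)) :
    IsPolynomialFunction m fun x => ∏ i ∈ Finset.range m, f i x := by
  induction m with
  | zero => exact ⟨1, by simp, by simp⟩
  | succ m ih =>
    simp only [Finset.prod_range_succ]
    exact ih.mul (hf m)

/-- The roots -(k+1), …, k are consecutive. The two largest give the quadratic, and in t = x-k+1 the
others are -1, …, -2k. -/
theorem prod_shifted_eq (k : ℕ) (x : ℝ) :
    (∏ j ∈ Finset.range (k + 1), (x - j)) * ∏ j ∈ Finset.range (k + 1), (x + (j + 1)) =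
      ((2 * k).factorial : ℝ) * ((x - k + 1) * (x - k) * leftProd k (x - k + 1)) := by
  have h1 : ∏ i ∈ Finset.range ((k + 1) + (k + 1)), (x - k + i) =
      (∏ j ∈ Finset.range (k + 1), (x - j)) * ∏ j ∈ Finset.range (k + 1), (x + (j + 1)) := by
    rw [Finset.prod_range_add, ← Finset.prod_range_reflect (fun j : ℕ => x - (j : ℝ))]
    congr 1
    · refine Finset.prod_congr rfl fun j hj => ?_
      have : j ≤ k := Nat.lt_succ_iff.1 (Finset.mem_range.1 hj)
      rw [show k + 1 - 1 - j = k - j by omega, Nat.cast_sub this]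
      ring
    · refine Finset.prod_congr rfl fun j _ => ?_
      push_cast
      ring
  have h2 : ∀ (m : ℕ) (t : ℝ), ∏ j ∈ Finset.range m, (t + ((j : ℝ) + 1)) =
      (m.factorial : ℝ) * ∏ j ∈ Finset.range m, (1 + t / ((j : ℝ) + 1)) := by
    intro m t
    rw [← Finset.prod_range_add_one_eq_factorial, Nat.cast_prod, ← Finset.prod_mul_distrib]
    refine Finset.prod_congr rfl fun j _ => ?_
    push_cast
    field_simp
    ring
  rw [← h1, show k + 1 + (k + 1) = 2 * k + 1 + 1 by ring, Finset.prod_range_succ',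
    Finset.prod_range_succ', leftProd]
  have h3 := h2 (2 * k) (x - k + 1)
  have h4 : ∏ j ∈ Finset.range (2 * k), (x - k + (((j + 1 + 1 : ℕ)) : ℝ)) =
      ∏ j ∈ Finset.range (2 * k), (x - k + 1 + ((j : ℝ) + 1)) :=
    Finset.prod_congr rfl fun j _ => by push_cast; ring
  rw [h4, h3]
  push_cast
  ring

theorem isPolynomialFunction_rightProd (k : ℕ) (c : ℝ) :
    IsPolynomialFunction k fun x => rightProd k (x + c) := by
  refine IsPolynomialFunction.prod k _ fun i => ?_
  convert IsPolynomialFunction.affine (1 - c / (2 * (i : ℝ) + 5 / 2)) (-(1 / (2 * (i : ℝ) + 5 / 2)))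
    using 2
  ring

theorem isPolynomialFunction_bump (R c : ℝ) :
    IsPolynomialFunction 3 fun x => bump R (x + c) := by
  have := (IsPolynomialFunction.affine (1 + c / R) (1 / R)).mul
    ((IsPolynomialFunction.affine (1 - balanceSlope (1 + 1 / R) * c)
      (-balanceSlope (1 + 1 / R))).pow 2)
  convert this using 2
  rw [bump]
  ring

/-- The normalised certificate: at least `1` on `[k - 1, k]` and at most `1` elsewhere. -/
theorem peak_bump_decay_bounds {k N L n : ℕ} (hk : 1 ≤ k) {R : ℝ} (hR : R = 640 * k)
    (hN : (N : ℝ) * k = 96 * R ^ 2) (hL1 : 4 * k + 2 + 3 * N ≤ L)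
    (hL2 : 5 * (1280 * k) + 4 * k + 5 * N ≤ L) (hLeven : Even L) {w : Polynomial ℝ}
    (hw1 : ∀ x : ℝ, k - 1 ≤ x → x ≤ k → 1 ≤ w.eval x)
    (hw2 : ∀ x : ℝ, 0 ≤ x → x ≤ n → x ≤ k - 1 ∨ (k : ℝ) ≤ x → |w.eval x| ≤ 1)
    (hw3 : ∀ x : ℝ, 1280 * k ≤ x → x ≤ n → |w.eval x| ≤ 1280 * k / x / 2)
    {x : ℝ} (hx0 : 0 ≤ x) (hxn : x ≤ n) :
    0 ≤ (x - k + 1) * (x - k) *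
      (1 - peak k (x - k + 1) * bump R (x - k + 1) ^ N * w.eval x ^ L) := by
  have hk1 : (1 : ℝ) ≤ k := by exact_mod_cast hk
  have hR1 : 1 ≤ R := by linarith
  set t := x - k + 1 with ht
  have htx : x - k = t - 1 := by rw [ht]; ring
  rw [htx]
  by_cases hin : 0 ≤ t ∧ t ≤ 1
  · obtain ⟨h0, h1⟩ := hin
    have e1 := one_le_peak k h0 h1
    have e2 := one_le_pow₀ (one_le_bump hR1 h0 h1) (n := N)
    have e3 := one_le_pow₀ (hw1 x (by linarith) (by linarith)) (n := L)
    have e4 := one_le_mul_of_one_le_of_one_le (one_le_mul_of_one_le_of_one_le e1 e2) e3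
    exact mul_nonneg_of_nonpos_of_nonpos
      (mul_nonpos_of_nonneg_of_nonpos h0 (by linarith)) (by linarith)
  · have hout : t ≤ 0 ∨ 1 ≤ t := by
      by_contra hcon
      push Not at hcon
      exact hin ⟨hcon.1.le, hcon.2.le⟩
    -- x ≥ 0 gives t ≥ 1 - k, well inside the range where `bump` is controlled.
    have htR : -R ≤ t := by linarith
    have hb0 := pow_nonneg (bump_nonneg hR1 htR) N
    have habs : peak k t * bump R t ^ N * w.eval x ^ L ≤
        |peak k t| * bump R t ^ N * |w.eval x| ^ L := by
      rw [hLeven.pow_abs]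
      refine mul_le_mul_of_nonneg_right ?_ (hLeven.pow_nonneg _)
      exact mul_le_mul_of_nonneg_right (le_abs_self _) hb0
    have hle : |peak k t| * bump R t ^ N * |w.eval x| ^ L ≤ 1 := by
      by_cases h2 : t ≤ 2 * R
      · refine mul_le_one₀ (peak_mul_bump_pow_le_one hk hR1 hN htR h2 hout)
          (pow_nonneg (abs_nonneg _) L) (pow_le_one₀ (abs_nonneg _) (hw2 x hx0 hxn ?_))
        rcases hout with h | h
        · left; linarith
        · right; linarith
      · push Not at h2
        -- As k ≥ 1, the decay of w in terms of x is at least as strong in terms of t.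
        have hxt : t ≤ x := by linarith
        refine peak_mul_bump_pow_growth (T := 1280 * k) (by omega) hR1 (by push_cast; linarith)
          (by push_cast; linarith) hL1 hL2 ?_
        refine (hw3 x (by linarith) hxn).trans ?_
        push_cast
        gcongr
        linarith
    have h3 : 0 ≤ t * (t - 1) := by rcases hout with h | h <;> nlinarith
    exact mul_nonneg h3 (by linarith)

theorem exists_certificate {n k : ℕ} (hk : 1 ≤ k) (hkn : k ≤ n) :
    ∃ (s : Polynomial ℝ) (d : ℕ), (d : ℝ) ≤ 10 ^ 11 * Real.sqrt (k * n) ∧ s.natDegree ≤ d ∧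
      IsSosModBoolean d (Polynomial.aeval (∑ i : Fin n, MvPolynomial.X i) s :
        MvPolynomial (Fin n) ℝ) ∧
      ∀ x : ℝ, 0 ≤ x → x ≤ n → 0 ≤ (x - k + 1) * (x - k) - s.eval x := by
  have hk1 : (1 : ℝ) ≤ k := by exact_mod_cast hk
  obtain ⟨w, hwdeg, hw1, hw2, hw3⟩ := exists_decaying_polynomial_nat hk hkn
  -- M and L are half the exponents used, the other half coming from squaring H. M is fixed by 2M·k
  -- = 96·(640k)²; L is a round number for which 2L exceeds both growth exponents, the larger being
  -- 5·1280k + 4k + 5·2M.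
  obtain ⟨M, hM⟩ : ∃ M : ℕ, M = 19660800 * k := ⟨_, rfl⟩
  obtain ⟨L, hL⟩ : ∃ L : ℕ, L = 100000000 * k := ⟨_, rfl⟩
  obtain ⟨R, hR⟩ : ∃ R : ℝ, R = 640 * k := ⟨_, rfl⟩
  have hM' : (M : ℝ) = 19660800 * k := by rw [hM]; push_cast; ring
  have hL' : (L : ℝ) = 100000000 * k := by rw [hL]; push_cast; ring
  obtain ⟨H, hHdeg, hH⟩ : IsPolynomialFunction (k + 1 + M * 3 + L * w.natDegree) fun x =>
      rightProd k (x + (1 - k)) * ((1 - balanceSlope (balanceRatio k) * (1 - k)) +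
        (-balanceSlope (balanceRatio k)) * x) * bump R (x + (1 - k)) ^ M * w.eval x ^ L :=
    (((isPolynomialFunction_rightProd k _).mul (IsPolynomialFunction.affine _ _)).mul
      ((isPolynomialFunction_bump R _).pow M)).mul
      (IsPolynomialFunction.pow ⟨w, le_rfl, fun _ => rfl⟩ L)
  obtain ⟨p, hpdeg, hp⟩ : IsPolynomialFunction ((k + 1) + (k + 1)) fun x =>
      (∏ j ∈ Finset.range (k + 1), (x - j)) * ∏ j ∈ Finset.range (k + 1), (x + (j + 1)) := by
    refine (IsPolynomialFunction.prod _ _ fun i => ?_).mul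
      (IsPolynomialFunction.prod _ _ fun i => ?_)
    · convert IsPolynomialFunction.affine (-(i : ℝ)) 1 using 2
      ring
    · convert IsPolynomialFunction.affine ((i : ℝ) + 1) 1 using 2
      ring
  set c : ℝ := 1 / ((2 * k).factorial : ℝ) with hc
  have hfac : ((2 * k).factorial : ℝ) ≠ 0 := by positivity
  set s : Polynomial ℝ := Polynomial.C c * p * H ^ 2 with hs
  have hseval : ∀ x : ℝ, s.eval x = c * ((∏ j ∈ Finset.range (k + 1), (x - j)) *
      ∏ j ∈ Finset.range (k + 1), (x + (j + 1))) * H.eval x ^ 2 := by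
    intro x
    rw [hs, Polynomial.eval_mul, Polynomial.eval_mul, Polynomial.eval_C, Polynomial.eval_pow, hp]
  have hsdeg : s.natDegree ≤ 2 * (k + 1) + 2 * H.natDegree := by
    refine Polynomial.natDegree_mul_le.trans (add_le_add ?_ Polynomial.natDegree_pow_le)
    exact (Polynomial.natDegree_C_mul_le _ _).trans (hpdeg.trans (by omega))
  obtain ⟨d, hd⟩ : ∃ d : ℕ, d = 2 * ((k + 1) + (k + 1) + (k + 1 + M * 3 + L * w.natDegree)) :=
    ⟨_, rfl⟩
  refine ⟨s, d, ?_, by omega, isSosModBoolean_aeval (by positivity) H s (by omega) (by omega) hseval,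
    fun x hx0 hxn => ?_⟩
  · have hksqrt : (k : ℝ) ≤ Real.sqrt (k * n) := by
      refine Real.le_sqrt_of_sq_le ?_
      have : (k : ℝ) ≤ n := by exact_mod_cast hkn
      nlinarith
    rw [hd]
    push_cast
    rw [hM', hL']
    have h1 : 100000000 * (k : ℝ) * w.natDegree = 100000000 * (k * w.natDegree) := by ring
    rw [h1]
    linarith
  · have hmain := peak_bump_decay_bounds (N := 2 * M) (L := 2 * L) (n := n) hk hR
      (by push_cast; rw [hM', hR]; ring) (by omega) (by omega) (even_two_mul L) hw1 hw2 hw3 hx0 hxn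
    have heq : s.eval x = (x - k + 1) * (x - k) *
        (peak k (x - k + 1) * bump R (x - k + 1) ^ (2 * M) * w.eval x ^ (2 * L)) := by
      rw [hseval, prod_shifted_eq, hH, hc, peak]
      beta_reduce
      rw [show x + (1 - (k : ℝ)) = x - k + 1 by ring,
        ← mul_assoc, one_div_mul_cancel hfac, pow_mul', pow_mul']
      ring
    rw [heq]
    linarith

theorem mainTheorem2 :
    ∃ C : ℝ, 0 < C ∧ ∀ n k : ℕ, 2 ≤ n → 1 ≤ k → k ≤ n →
      ∃ (s : Polynomial ℝ) (d : ℕ),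
        (d : ℝ) ≤ C * (Real.sqrt ((k : ℝ) * (n : ℝ)) * Real.log (n : ℝ)) ∧
        s.natDegree ≤ d ∧
        IsSosModBoolean d (Polynomial.aeval (∑ i : Fin n, MvPolynomial.X i) s :
          MvPolynomial (Fin n) ℝ) ∧
        ∀ x : ℝ, x ∈ Set.Icc (0 : ℝ) (n : ℝ) →
          0 ≤ (x - (k : ℝ) + 1) * (x - (k : ℝ)) - s.eval x := by
  have hlog2 : 0 < Real.log 2 := Real.log_pos one_lt_two
  refine ⟨10 ^ 11 / Real.log 2, by positivity, fun n k hn hk hkn => ?_⟩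
  obtain ⟨s, d, hd, hs, hsos, hle⟩ := exists_certificate hk hkn
  refine ⟨s, d, hd.trans ?_, hs, hsos, fun x hx => hle x hx.1 hx.2⟩
  -- The bound without logarithm is already available; n ≥ 2 only serves to make log n / log 2 at
  -- least 1.
  have hlog : Real.log 2 ≤ Real.log n :=
    Real.log_le_log two_pos (by exact_mod_cast hn)
  have h1 : 1 ≤ Real.log n / Real.log 2 := (one_le_div hlog2).2 hlog
  calc 10 ^ 11 * Real.sqrt (k * n) = 10 ^ 11 * Real.sqrt (k * n) * 1 := (mul_one _).symm
    _ ≤ 10 ^ 11 * Real.sqrt (k * n) * (Real.log n / Real.log 2) := by gcongr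
    _ = _ := by ring
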